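/- All graphs are finite, simple and undirected. For a connected graph $H$ (with at least one vertex) and a path $P$ in $H$, the \emph{eccentricity} of $P$ is the maximum, over all vertices $x$ of $H$, of the distance in $H$ from $x$ to the nearest vertex of $P$; a single vertex is a path. The \emph{path eccentricity} $\mathrm{pe}(H)$ is the minimum eccentricity of a path in $H$. For an integer $k\ge 1$, the \emph{$k$-subdivided claw} $S_k$ is the graph obtained from the claw $K_{1,3}$ by replacing each of its edges with a path with $k$ edges, and the \emph{$k$-subdivided net} $T_k$ is the graph obtained from the complete graph $K_3$ by appending a path with $k$ edges to each of its vertices. \textbf{Theorem.} For every integer $k\ge 1$ and every graph $G$, the following statements are equivalent: (i) every connected induced subgraph $H$ of $G$ satisfies $\mathrm{pe}(H)<k$; (ii) no induced subgraph of $G$ is isomorphic to $S_k$ or to $T_k$. Moreover, $\mathrm{pe}(S_k)=\mathrm{pe}(T_k)=k$ for every integer $k\ge 1$. -/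

import Mathlib

namespace SimpleGraph

/-- The eccentricity of a walk `p` in `G`: the maximum, over all vertices `x` of `G`, of the
distance in `G` from `x` to the nearest vertex of `p`. It is `⊤` if some vertex cannot reach `p`
(impossible in a connected graph). -/
noncomputable def Walk.eccentricity {V : Type*} {G : SimpleGraph V} {u v : V}
    (p : G.Walk u v) : ℕ∞ :=
  ⨆ x : V, ⨅ y ∈ p.support, G.edist x y

/-- The path eccentricity of `G`: the minimum eccentricity of a path in `G`. -/
noncomputable def pathEccentricity {V : Type*} (G : SimpleGraph V) : ℕ∞ :=
  ⨅ (u : V) (v : V) (p : G.Walk u v) (_ : p.IsPath), p.eccentricity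

/-- The `k`-subdivided claw. The vertex `none` is the centre, and `some (i, 0)`, ...,
`some (i, k - 1)` are, in order, the other vertices of the `i`-th path of length `k` that starts
at the centre. -/
def subdividedClaw (k : ℕ) : SimpleGraph (Option (Fin 3 × Fin k)) where
  Adj
    | none, none => False
    | none, some (_, b) => b.val = 0
    | some (_, a), none => a.val = 0
    | some (i, a), some (j, b) => i = j ∧ (a.val + 1 = b.val ∨ b.val + 1 = a.val)
  symm := ⟨by
    rintro (_ | ⟨i, a⟩) (_ | ⟨j, b⟩) h
    · exact h
    · exact h
    · exact h
    · exact ⟨h.1.symm, h.2.symm⟩⟩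
  loopless := ⟨by
    rintro (_ | ⟨i, a⟩) h
    · exact h
    · rcases h.2 with h | h <;> omega⟩

/-- The `k`-subdivided net. The vertices `(0, 0)`, `(1, 0)`, `(2, 0)` form a triangle, and
`(i, 0)`, ..., `(i, k)` are, in order, the vertices of the path of length `k` appended to
`(i, 0)`. -/
def subdividedNet (k : ℕ) : SimpleGraph (Fin 3 × Fin (k + 1)) where
  Adj x y :=
    (x.1 = y.1 ∧ (x.2.val + 1 = y.2.val ∨ y.2.val + 1 = x.2.val)) ∨
      (x.1 ≠ y.1 ∧ x.2.val = 0 ∧ y.2.val = 0)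
  symm := ⟨by
    rintro x y (h | h)
    · exact Or.inl ⟨h.1.symm, h.2.symm⟩
    · exact Or.inr ⟨h.1.symm, h.2.2, h.2.1⟩⟩
  loopless := ⟨by
    rintro x (h | h)
    · rcases h.2 with h | h <;> omega
    · exact h.1 rfl⟩

end SimpleGraph

/-! The heart of the proof is a peeling argument. Every connected graph has a connected dominating
set `S` in which any three non-cut vertices have pairwise nonadjacent private neighbours
(`exists_hasPrivateTriples`). Hence an induced claw or net inside `S` can be lengthened by one
vertex at each of its three ends (`IsConnOn.exists_extension`): a leaf is either a non-cut vertex of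
`S`, with a private neighbour available, or part of `S` hangs on it. So if `G` excludes `S_{k+1}`
and `T_{k+1}`, then `G[S]` excludes `S_k` and `T_k`. As `S` dominates, a path of `G[S]` gains at
most one in eccentricity when viewed in `G`, and induction on `k` applies.

The base case `k = 1` asks for a Hamiltonian path in a connected graph without induced claws and
nets. The same `S` contains no triangle, since a triangle is `T_0` and would grow to a net. Being
also connected and claw-free, `S` is traced by a path, and claw-freeness lets all dominated vertices
be inserted into that path.

The set `S` comes from an extremal choice: fewest non-cut vertices, then greatest weight, then
greatest size. If a private neighbour were missing, `IsOptimal.exchange_false` would trade a non-cut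
vertex for at most two pendant ones and improve `S`.

Conversely, each of `S_k` and `T_k` has three disjoint deep parts, each with a single exit. A path
that visits such a part must end in it or lie in it, and a path has only two ends
(`not_hasCentralPath`). -/

namespace SimpleGraph

open Finset Classical

variable {V : Type*} {G : SimpleGraph V}

/-! ### Connected vertex sets, height functions and non-cut vertices -/

/-- `S` is nonempty and induces a connected subgraph: a nonempty subset of `S` that is closed
under adjacency inside `S` is all of `S`. -/
def IsConnOn (G : SimpleGraph V) (S : Finset V) : Prop :=
  S.Nonempty ∧ ∀ A : Set V, (∃ a ∈ A, a ∈ S) →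
    (∀ a ∈ A, a ∈ S → ∀ b ∈ S, G.Adj a b → b ∈ A) → ∀ b ∈ S, b ∈ A

/-- The vertices of `S` whose deletion leaves a connected set. -/
noncomputable def nonCut (G : SimpleGraph V) (S : Finset V) : Finset V :=
  S.filter fun w => G.IsConnOn (S.erase w)

/-- A height function on `S` certifying that `S` is connected: every vertex other than the root
`r` has a neighbour in `S` that is one lower. -/
def IsRooted (G : SimpleGraph V) (S : Finset V) (r : V) (h : V → ℕ) : Prop :=
  r ∈ S ∧ h r = 0 ∧ ∀ y ∈ S, y ≠ r → ∃ z ∈ S, G.Adj y z ∧ h z + 1 = h y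

lemma mem_nonCut {S : Finset V} {w : V} :
    w ∈ G.nonCut S ↔ w ∈ S ∧ G.IsConnOn (S.erase w) := by
  simp [nonCut]

lemma IsRooted.isConnOn {S : Finset V} {r : V} {h : V → ℕ} (H : G.IsRooted S r h) :
    G.IsConnOn S := by
  obtain ⟨hr, hr0, hp⟩ := H
  refine ⟨⟨r, hr⟩, fun A ⟨a, haA, haS⟩ hA => ?_⟩
  have hrA : r ∈ A := by
    have key : ∀ n a, h a = n → a ∈ A → a ∈ S → r ∈ A := by
      intro n
      induction n with
      | zero =>
        intro a ha haA haS
        by_cases har : a = r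
        · exact har ▸ haA
        · obtain ⟨z, -, -, hz⟩ := hp a haS har
          omega
      | succ n ih =>
        intro a ha haA haS
        by_cases har : a = r
        · exact har ▸ haA
        · obtain ⟨z, hzS, hz1, hz⟩ := hp a haS har
          exact ih z (by omega) (hA a haA haS z hzS hz1) hzS
    exact key _ a rfl haA haS
  have key : ∀ n b, h b = n → b ∈ S → b ∈ A := by
    intro n
    induction n with
    | zero =>
      intro b hb hbS
      by_cases hbr : b = r
      · exact hbr ▸ hrA
      · obtain ⟨z, -, -, hz⟩ := hp b hbS hbr
        omega
    | succ n ih =>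
      intro b hb hbS
      by_cases hbr : b = r
      · exact hbr ▸ hrA
      · obtain ⟨z, hzS, hz1, hz⟩ := hp b hbS hbr
        exact hA z (ih z (by omega) hzS) hzS b hbS hz1.symm
  exact fun b hb => key _ b rfl hb

lemma IsRooted.insert {S : Finset V} {r a b : V} {h : V → ℕ} (H : G.IsRooted S r h)
    (ha : a ∈ S) (hb : b ∉ S) (hab : G.Adj a b) :
    G.IsRooted (insert b S) r (Function.update h b (h a + 1)) := by
  obtain ⟨hr, hr0, hp⟩ := H
  have hne : ∀ y ∈ S, y ≠ b := fun y hy hyb => hb (hyb ▸ hy)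
  refine ⟨mem_insert_of_mem hr, ?_, fun y hy hyr => ?_⟩
  · rw [Function.update_of_ne (hne r hr), hr0]
  · rcases mem_insert.1 hy with rfl | hy
    · exact ⟨a, mem_insert_of_mem ha, hab.symm, by
        rw [Function.update_of_ne (hne a ha), Function.update_self]⟩
    · obtain ⟨z, hzS, hz1, hz⟩ := hp y hy hyr
      exact ⟨z, mem_insert_of_mem hzS, hz1, by
        rw [Function.update_of_ne (hne z hzS), Function.update_of_ne (hne y hy), hz]⟩

lemma IsConnOn.exists_adj_of_ne {S T : Finset V} (hS : G.IsConnOn S) (hT : T.Nonempty)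
    (hTS : T ⊆ S) (hne : T ≠ S) : ∃ a ∈ T, ∃ b ∈ S, b ∉ T ∧ G.Adj a b := by
  by_contra! hcon
  refine hne (hTS.antisymm fun b hb => ?_)
  obtain ⟨t, ht⟩ := hT
  refine hS.2 (↑T) ⟨t, ht, hTS ht⟩ (fun a ha _ b hb hab => ?_) b hb
  by_contra hbT
  exact hcon a ha b hb hbT hab

lemma IsConnOn.exists_isRooted {S : Finset V} (hS : G.IsConnOn S) {r : V} (hr : r ∈ S) :
    ∃ h, G.IsRooted S r h := by
  have key : ∀ n, ∀ T ⊆ S, #S - #T = n → (∃ h, G.IsRooted T r h) → ∃ h, G.IsRooted S r h := by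
    intro n
    induction n with
    | zero =>
      intro T hT hn ⟨h, hh⟩
      rw [← eq_of_subset_of_card_le hT (by omega)]
      exact ⟨h, hh⟩
    | succ n ih =>
      intro T hT hn ⟨h, hh⟩
      obtain ⟨a, ha, b, hb, hbT, hab⟩ := hS.exists_adj_of_ne ⟨r, hh.1⟩ hT
        (by rintro rfl; omega)
      refine ih (insert b T) (insert_subset hb hT) ?_ ⟨_, hh.insert ha hbT hab⟩
      rw [card_insert_of_notMem hbT]
      omega
  exact key _ {r} (by simpa using hr) rfl ⟨fun _ => 0, by simp [IsRooted]⟩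

/-- Descending from `y` to the root meets every height from `h y` down to `0`. The bound keeps the
truncated subtraction in `nonCutWeight` honest. -/
lemma IsRooted.lt_card {S : Finset V} {r : V} {h : V → ℕ} (H : G.IsRooted S r h) {y : V}
    (hy : y ∈ S) : h y < #S := by
  have key : ∀ n y, y ∈ S → h y = n → ∀ m ≤ n, m ∈ S.image h := by
    intro n
    induction n with
    | zero =>
      intro y hy hn m hm
      exact mem_image.2 ⟨y, hy, by omega⟩
    | succ n ih =>
      intro y hy hn m hm
      rcases Nat.lt_or_ge n m with h1 | h1
      · exact mem_image.2 ⟨y, hy, by omega⟩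
      · have hyr : y ≠ r := by
          rintro rfl
          have := H.2.1
          omega
        obtain ⟨z, hz, -, hzy⟩ := H.2.2 y hy hyr
        exact ih z hz (by omega) m h1
  have h1 : range (h y + 1) ⊆ S.image h := fun m hm =>
    key _ y hy rfl m (by simpa [Nat.lt_succ_iff] using hm)
  have h2 := card_le_card h1
  have h3 := card_image_le (s := S) (f := h)
  rw [card_range] at h2
  omega

lemma IsConnOn.insert {S : Finset V} (hS : G.IsConnOn S) {a b : V} (ha : a ∈ S)
    (hab : G.Adj a b) : G.IsConnOn (insert b S) := by
  by_cases hb : b ∈ S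
  · rwa [insert_eq_of_mem hb]
  · obtain ⟨h, hh⟩ := hS.exists_isRooted ha
    exact (hh.insert ha hb hab).isConnOn

lemma IsConnOn.exists_adj {S : Finset V} (hS : G.IsConnOn S) {a : V} (ha : a ∈ S)
    (hcard : 2 ≤ #S) : ∃ b ∈ S, G.Adj a b := by
  obtain ⟨x, hx, b, hb, -, hab⟩ := hS.exists_adj_of_ne (T := {a}) (by simp) (by simpa using ha)
    (by rintro rfl; simp at hcard)
  rw [mem_singleton] at hx
  exact ⟨b, hb, hx ▸ hab⟩

/-- Behind a set that hangs on a single vertex there is a vertex that is not a cut vertex. -/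
lemma IsConnOn.exists_mem_nonCut {S : Finset V} (hS : G.IsConnOn S) {f : V} (hf : f ∈ S)
    {A : Finset V} (hAS : A ⊆ S) (hA : A.Nonempty) (hfA : f ∉ A)
    (hcl : ∀ a ∈ A, ∀ b ∈ S, G.Adj a b → b ∈ A ∨ b = f) : ∃ u ∈ A, u ∈ G.nonCut S := by
  obtain ⟨h, hh⟩ := hS.exists_isRooted hf
  -- With heights measured from `f`, a highest vertex of `A` is nobody's parent: all its neighbours
  -- in `S` lie in `A` or equal `f`.
  obtain ⟨u, hu, hmax⟩ := exists_max_image A h hA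
  have huf : f ≠ u := fun e => hfA (e ▸ hu)
  refine ⟨u, hu, mem_nonCut.2 ⟨hAS hu, ?_⟩⟩
  refine IsRooted.isConnOn (r := f) (h := h) ⟨mem_erase.2 ⟨huf, hf⟩, hh.2.1, fun y hy hyf => ?_⟩
  obtain ⟨hyu, hyS⟩ := mem_erase.1 hy
  obtain ⟨z, hz, hyz, hzh⟩ := hh.2.2 y hyS hyf
  refine ⟨z, mem_erase.2 ⟨?_, hz⟩, hyz, hzh⟩
  rintro rfl
  rcases hcl z hu y hyS hyz.symm with h1 | h1
  · have := hmax y h1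
    omega
  · exact hyf h1

/-! ### Dominating sets, private neighbours and pendant vertices -/

/-- Every vertex is in `S` or adjacent to a vertex of `S`. -/
def IsDominatingSet (G : SimpleGraph V) (S : Finset V) : Prop :=
  ∀ v, v ∈ S ∨ ∃ y ∈ S, G.Adj v y

/-- `z` is a vertex outside `S` whose only neighbour in `S` is `u`. -/
def IsPrivate (G : SimpleGraph V) (S : Finset V) (u z : V) : Prop :=
  z ∉ S ∧ ∀ y ∈ S, G.Adj z y ↔ y = u

lemma IsPrivate.mono {S T : Finset V} {u z : V} (h : G.IsPrivate S u z) (hTS : T ⊆ S) :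
    G.IsPrivate T u z :=
  ⟨fun hz => h.1 (hTS hz), fun y hy => h.2 y (hTS hy)⟩

lemma IsPrivate.eq {S : Finset V} {u v z : V} (h : G.IsPrivate S u z) (h' : G.IsPrivate S v z)
    (hu : u ∈ S) : u = v :=
  (h'.2 u hu).1 ((h.2 u hu).2 rfl)

lemma IsRooted.union_image {S P : Finset V} {r : V} {h : V → ℕ} {p : V → V}
    (H : G.IsRooted S r h) (hPS : P ⊆ S) (hp : ∀ u ∈ P, G.IsPrivate S u (p u)) :
    ∃ h' : V → ℕ, G.IsRooted (S ∪ P.image p) r h' ∧ (∀ y ∈ S, h' y = h y) ∧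
      ∀ u ∈ P, h' (p u) = h u + 1 := by
  -- The choice of `u` is harmless, since a private neighbour determines the vertex it hangs on; the
  -- value `0` elsewhere is never used.
  set h' : V → ℕ := fun y => if y ∈ S then h y else
    if H : ∃ u ∈ P, p u = y then h H.choose + 1 else 0 with hh'
  have h1 : ∀ y ∈ S, h' y = h y := fun y hy => by simp [hh', hy]
  have h2 : ∀ u ∈ P, h' (p u) = h u + 1 := fun u hu => by
    have hex : ∃ u' ∈ P, p u' = p u := ⟨u, hu, rfl⟩
    have h3 : hex.choose = u := by
      obtain ⟨h4, h5⟩ := hex.choose_spec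
      have h6 := hp _ h4
      rw [h5] at h6
      exact h6.eq (hp u hu) (hPS h4)
    simp only [hh', (hp u hu).1, if_false, hex, dif_pos]
    rw [h3]
  refine ⟨h', ⟨mem_union_left _ H.1, by rw [h1 _ H.1, H.2.1], fun y hy hyr => ?_⟩, h1, h2⟩
  rcases mem_union.1 hy with hy | hy
  · obtain ⟨z, hz, hyz, hzh⟩ := H.2.2 y hy hyr
    exact ⟨z, mem_union_left _ hz, hyz, by rw [h1 z hz, h1 y hy, hzh]⟩
  · obtain ⟨u, hu, rfl⟩ := mem_image.1 hy
    exact ⟨u, mem_union_left _ (hPS hu), ((hp u hu).2 u (hPS hu)).2 rfl, by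
      rw [h1 u (hPS hu), h2 u hu]⟩

lemma IsConnOn.union_image {S P : Finset V} {p : V → V} (hS : G.IsConnOn S) (hPS : P ⊆ S)
    (hp : ∀ u ∈ P, G.IsPrivate S u (p u)) : G.IsConnOn (S ∪ P.image p) := by
  obtain ⟨r, hr⟩ := hS.1
  obtain ⟨h, hh⟩ := hS.exists_isRooted hr
  obtain ⟨h', hh', -⟩ := hh.union_image hPS hp
  exact hh'.isConnOn

/-- Attaching pairwise nonadjacent pendant vertices creates no new non-cut vertex but the
pendant vertices, and makes cut vertices of the vertices that they are attached to. -/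
lemma nonCut_union_image_subset {S P : Finset V} {p : V → V} (hS : 2 ≤ #S)
    (hp : ∀ u ∈ P, G.IsPrivate S u (p u))
    (hpp : ∀ u ∈ P, ∀ v ∈ P, ¬ G.Adj (p u) (p v)) :
    G.nonCut (S ∪ P.image p) ⊆ (G.nonCut S \ P) ∪ P.image p := by
  intro y hy
  obtain ⟨hyS, hyc⟩ := mem_nonCut.1 hy
  rcases mem_union.1 hyS with hyS | hyS
  swap
  · exact mem_union_right _ hyS
  obtain ⟨s, hs, hsy⟩ := exists_mem_ne (by omega : 1 < #S) y
  refine mem_union_left _ (mem_sdiff.2 ⟨mem_nonCut.2 ⟨hyS, ⟨s, by simp [hs, hsy]⟩, ?_⟩, ?_⟩)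
  · rintro A ⟨a, haA, haS⟩ hcl b hb
    have hbS := mem_of_mem_erase hb
    -- The closed set `A` is enlarged by the pendant vertices attached to it, so that it stays
    -- closed in the larger graph.
    have key := hyc.2 {x | (x ∈ A ∧ x ∈ S.erase y) ∨ ∃ u ∈ P, u ∈ A ∧ u ∈ S.erase y ∧ x = p u}
      ⟨a, Or.inl ⟨haA, haS⟩, by simp at haS ⊢; tauto⟩ ?_ b (by simp at hb ⊢; tauto)
    · rcases key with h | ⟨u, hu, -, -, rfl⟩
      · exact h.1
      · exact absurd hbS (hp u hu).1
    · intro x hx _ z hz hxz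
      obtain ⟨hzy, hz⟩ := mem_erase.1 hz
      rcases hx with ⟨hxA, hxS⟩ | ⟨u, hu, huA, huS, rfl⟩
      · rcases mem_union.1 hz with hz | hz
        · exact Or.inl ⟨hcl x hxA hxS z (mem_erase.2 ⟨hzy, hz⟩) hxz, mem_erase.2 ⟨hzy, hz⟩⟩
        · obtain ⟨v, hv, rfl⟩ := mem_image.1 hz
          have : x = v := ((hp v hv).2 x (mem_of_mem_erase hxS)).1 hxz.symm
          subst this
          exact Or.inr ⟨x, hv, hxA, hxS, rfl⟩
      · rcases mem_union.1 hz with hz | hz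
        · have : z = u := ((hp u hu).2 z hz).1 hxz
          subst this
          exact Or.inl ⟨huA, huS⟩
        · obtain ⟨v, hv, rfl⟩ := mem_image.1 hz
          exact absurd hxz (hpp u hu v hv)
  · intro hyP
    -- If `y ∈ P`, deleting `y` isolates `p y`, while some `s ≠ y` of `S` remains.
    have hne : p y ≠ y := fun e => (hp y hyP).1 (e.symm ▸ hyS)
    have := hyc.2 {p y} ⟨p y, rfl, mem_erase.2 ⟨hne, mem_union_right _ (mem_image_of_mem _ hyP)⟩⟩
      ?_ s (by simp [hs, hsy])
    · exact (hp y hyP).1 (by rwa [← Set.mem_singleton_iff.1 this])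
    · rintro _ rfl _ b hb hyb
      obtain ⟨hby, hb⟩ := mem_erase.1 hb
      rcases mem_union.1 hb with hb | hb
      · exact absurd (((hp y hyP).2 b hb).1 hyb) hby
      · obtain ⟨v, hv, rfl⟩ := mem_image.1 hb
        exact absurd hyb (hpp y hyP v hv)

/-- Deleting `w` makes a new non-cut vertex only of a vertex that `w` hangs on. -/
lemma mem_nonCut_or_of_mem_nonCut_erase {S : Finset V} {w y : V} (hw : w ∈ S)
    (hy : y ∈ G.nonCut (S.erase w)) : y ∈ G.nonCut S ∨ ∀ z ∈ S, G.Adj w z → z = y := by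
  obtain ⟨hyS, hyc⟩ := mem_nonCut.1 hy
  obtain ⟨hyw, hyS⟩ := mem_erase.1 hyS
  by_contra! hcon
  obtain ⟨h1, z, hz, hwz, hzy⟩ := hcon
  refine h1 (mem_nonCut.2 ⟨hyS, ?_⟩)
  -- A second neighbour `z ≠ y` reattaches `w` after the deletion of `y`.
  have h2 := hyc.insert (a := z) (b := w)
    (by simp [hz, hzy, hwz.ne']) hwz.symm
  rwa [erase_right_comm, insert_erase (mem_erase.2 ⟨hyw.symm, hw⟩)] at h2

/-! ### Optimal connected dominating sets and the exchange argument -/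

variable [Fintype V]

/-- The potential of a set `S` with height function `h`. -/
noncomputable def nonCutWeight (G : SimpleGraph V) (S : Finset V) (h : V → ℕ) : ℕ :=
  ∑ y ∈ G.nonCut S, 4 ^ (Fintype.card V - h y)

/-- `S` with root `r` and height function `h` is a connected dominating set that is optimal: it has
the fewest non-cut vertices and, subject to that, the lexicographically largest pair of weight and
cardinality. -/
structure IsOptimal (G : SimpleGraph V) (S : Finset V) (r : V) (h : V → ℕ) : Prop where
  isRooted : G.IsRooted S r h
  isDominatingSet : G.IsDominatingSet S
  card_le : ∀ S', G.IsConnOn S' → G.IsDominatingSet S' → #(G.nonCut S) ≤ #(G.nonCut S')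
  weight_le : ∀ S' r' h', G.IsRooted S' r' h' → G.IsDominatingSet S' →
    #(G.nonCut S') = #(G.nonCut S) → G.nonCutWeight S' h' ≤ G.nonCutWeight S h ∧
      (G.nonCutWeight S' h' = G.nonCutWeight S h → #S' ≤ #S)

/-- Since `#S ≤ n`, the lexicographic order on weight and cardinality is encoded in the single
number `weight * (n + 1) + #S`, which is bounded. -/
lemma exists_isOptimal (hG : G.IsConnOn univ) : ∃ S r h, G.IsOptimal S r h := by
  set n := Fintype.card V with hn
  obtain ⟨r₀, -⟩ := hG.1
  obtain ⟨h₀, hh₀⟩ := hG.exists_isRooted (mem_univ r₀)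
  let Q : ℕ → Prop := fun m => ∃ S, G.IsConnOn S ∧ G.IsDominatingSet S ∧ #(G.nonCut S) = m
  have hQ : ∃ m, Q m := ⟨_, univ, hG, fun v => Or.inl (mem_univ v), rfl⟩
  obtain ⟨S₁, hS₁c, hS₁d, hS₁⟩ := Nat.find_spec hQ
  have hmin : ∀ S', G.IsConnOn S' → G.IsDominatingSet S' → Nat.find hQ ≤ #(G.nonCut S') :=
    fun S' h1 h2 => Nat.find_min' hQ ⟨S', h1, h2, rfl⟩
  let R : ℕ → Prop := fun m => ∃ S r h, G.IsRooted S r h ∧ G.IsDominatingSet S ∧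
    #(G.nonCut S) = Nat.find hQ ∧ G.nonCutWeight S h * (n + 1) + #S = m
  have hcard : ∀ S : Finset V, #S ≤ n := fun S => card_le_univ S
  have hbound : ∀ m, R m → m ≤ n * 4 ^ n * (n + 1) + n := by
    rintro m ⟨S, r, h, -, -, -, rfl⟩
    have h1 : G.nonCutWeight S h ≤ n * 4 ^ n := by
      calc G.nonCutWeight S h ≤ ∑ _y ∈ G.nonCut S, 4 ^ n :=
            sum_le_sum fun y _ => Nat.pow_le_pow_right (by norm_num) (Nat.sub_le _ _)
        _ = #(G.nonCut S) * 4 ^ n := by simp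
        _ ≤ n * 4 ^ n := Nat.mul_le_mul_right _ (hcard _)
    exact Nat.add_le_add (Nat.mul_le_mul_right _ h1) (hcard S)
  obtain ⟨r₁, hr₁⟩ := hS₁c.1
  obtain ⟨h₁, hh₁⟩ := hS₁c.exists_isRooted hr₁
  have hR : R (G.nonCutWeight S₁ h₁ * (n + 1) + #S₁) := ⟨S₁, r₁, h₁, hh₁, hS₁d, hS₁, rfl⟩
  have hspec := Nat.findGreatest_spec (hbound _ hR) hR
  have hmax : ∀ m, R m → m ≤ Nat.findGreatest R (n * 4 ^ n * (n + 1) + n) :=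
    fun m hm => Nat.le_findGreatest (hbound _ hm) hm
  obtain ⟨S, r, h, h1, h2, h3, h4⟩ := hspec
  refine ⟨S, r, h, h1, h2, fun S' => by rw [h3]; exact hmin S', fun S' r' h' h1' h2' h3' => ?_⟩
  have h5 := hmax _ ⟨S', r', h', h1', h2', h3'.trans h3, rfl⟩
  rw [← h4] at h5
  have h6 := hcard S
  have h7 := hcard S'
  refine ⟨?_, fun e => by rw [e] at h5; omega⟩
  by_contra! hlt
  have h8 := Nat.mul_le_mul_right (n + 1) (Nat.succ_le_of_lt hlt)
  rw [Nat.succ_mul] at h8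
  omega

/-- The exchange: a non-cut vertex `w` of an optimal set cannot be replaced by at most two
pendant vertices that hang on non-cut vertices which are at least as high as `w`. -/
lemma IsOptimal.exchange_false {S P : Finset V} {r w : V} {h : V → ℕ} {p : V → V}
    (H : G.IsOptimal S r h) (h3 : 3 ≤ #(G.nonCut S)) (hw : w ∈ G.nonCut S)
    (hPn : P ⊆ G.nonCut S) (hwP : w ∉ P) (hP2 : #P ≤ 2) (hhP : ∀ u ∈ P, h w ≤ h u)
    (hp : ∀ u ∈ P, G.IsPrivate S u (p u)) (hpp : ∀ u ∈ P, ∀ v ∈ P, ¬ G.Adj (p u) (p v))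
    (hcov : ∀ z, G.IsPrivate S w z → ∃ u ∈ P, G.Adj z (p u)) : False := by
  obtain ⟨hwS, hwc⟩ := mem_nonCut.1 hw
  have hnS : G.nonCut S ⊆ S := filter_subset _ _
  have hS3 : 3 ≤ #S := h3.trans (card_le_card hnS)
  have hSc : G.IsConnOn S := H.isRooted.isConnOn
  have hP' : P ⊆ S.erase w := fun u hu => mem_erase.2 ⟨fun e => hwP (e ▸ hu), hnS (hPn hu)⟩
  have hp' : ∀ u ∈ P, G.IsPrivate (S.erase w) u (p u) :=
    fun u hu => (hp u hu).mono (erase_subset _ _)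
  have hinj : Set.InjOn p P := fun u hu v hv e =>
    (hp u hu).eq (e ▸ hp v hv) (hnS (hPn hu))
  have hpS : ∀ y ∈ P.image p, y ∉ S := by
    intro y hy
    obtain ⟨u, hu, rfl⟩ := mem_image.1 hy
    exact (hp u hu).1
  have herase : #(S.erase w) = #S - 1 := card_erase_of_mem hwS
  obtain ⟨b, hb, hwb⟩ := hSc.exists_adj hwS (by omega)
  set S' := S.erase w ∪ P.image p with hS'
  have hc' : G.IsConnOn S' := hwc.union_image hP' hp'
  -- Only `w` and its private neighbours could lose domination; the former has the neighbour `b`,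
  -- the latter are covered by `hcov`.
  have hd' : G.IsDominatingSet S' := by
    intro v
    by_cases hvw : v = w
    · exact Or.inr ⟨b, mem_union_left _ (mem_erase.2 ⟨hwb.ne', hb⟩), hvw ▸ hwb⟩
    by_cases hvS : v ∈ S
    · exact Or.inl (mem_union_left _ (mem_erase.2 ⟨hvw, hvS⟩))
    by_cases hvp : G.IsPrivate S w v
    · obtain ⟨u, hu, huv⟩ := hcov v hvp
      exact Or.inr ⟨p u, mem_union_right _ (mem_image_of_mem _ hu), huv⟩
    · obtain ⟨y, hy, hvy⟩ := (H.isDominatingSet v).resolve_left hvS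
      by_cases hyw : y = w
      · subst hyw
        have : ∃ z ∈ S, G.Adj v z ∧ z ≠ y := by
          by_contra! hcon
          exact hvp ⟨hvS, fun z hz => ⟨hcon z hz, fun e => e ▸ hvy⟩⟩
        obtain ⟨z, hz, hvz, hzy⟩ := this
        exact Or.inr ⟨z, mem_union_left _ (mem_erase.2 ⟨hzy, hz⟩), hvz⟩
      · exact Or.inr ⟨y, mem_union_left _ (mem_erase.2 ⟨hyw, hy⟩), hvy⟩
  have hmin := H.card_le S' hc' hd'
  set R := (G.nonCut S).erase w \ P with hR
  have hsub : G.nonCut S' ⊆ (G.nonCut (S.erase w) \ P) ∪ P.image p :=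
    nonCut_union_image_subset (by omega) hp' hpp
  have hPe : P ⊆ (G.nonCut S).erase w := fun u hu =>
    mem_erase.2 ⟨fun e => hwP (e ▸ hu), hPn hu⟩
  have hcardR : #R + #P + 1 = #(G.nonCut S) := by
    rw [hR, card_sdiff_of_subset hPe, card_erase_of_mem hw]
    have := card_le_card hPe
    rw [card_erase_of_mem hw] at this
    omega
  have hcardp : #(P.image p) = #P := card_image_of_injOn hinj
  have hmemR : ∀ y ∈ G.nonCut S', y ∉ R ∪ P.image p →
      y ∈ S.erase w ∧ y ∉ G.nonCut S ∧ ∀ z ∈ S, G.Adj w z → z = y := by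
    intro y hy hyR
    rcases mem_union.1 (hsub hy) with h1 | h1
    · obtain ⟨h1, h2⟩ := mem_sdiff.1 h1
      have h4 := (mem_nonCut.1 h1).1
      have h5 : y ∉ G.nonCut S := fun h5 => hyR (mem_union_left _
        (mem_sdiff.2 ⟨mem_erase.2 ⟨(mem_erase.1 h4).1, h5⟩, h2⟩))
      exact ⟨h4, h5, (mem_nonCut_or_of_mem_nonCut_erase hwS h1).resolve_left h5⟩
    · exact absurd (mem_union_right _ h1) hyR
  have hcardRp : #(R ∪ P.image p) ≤ #R + #P := hcardp ▸ card_union_le _ _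
  -- Without a new non-cut vertex from `S`, the count would drop below the minimum. The only
  -- candidate for one is `x`, the unique neighbour of `w` in `S`, and then the counts agree and the
  -- weights decide.
  by_cases hx : G.nonCut S' ⊆ R ∪ P.image p
  · have := card_le_card hx
    omega
  obtain ⟨x, hxn, hxR⟩ := not_subset.1 hx
  obtain ⟨hxS, hxnS, hxw⟩ := hmemR x hxn hxR
  obtain ⟨hxnw, hxS0⟩ := mem_erase.1 hxS
  have hwx : G.Adj w x := by rwa [← hxw b hb hwb]
  have hsub' : G.nonCut S' ⊆ insert x (R ∪ P.image p) := by
    intro y hy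
    by_cases hyR : y ∈ R ∪ P.image p
    · exact mem_insert_of_mem hyR
    · rw [mem_insert]
      left
      rw [← hxw b hb hwb]
      exact ((hmemR y hy hyR).2.2 b hb hwb).symm
  have hcard' : #(insert x (R ∪ P.image p)) = #(R ∪ P.image p) + 1 := card_insert_of_notMem hxR
  have heq : G.nonCut S' = insert x (R ∪ P.image p) :=
    eq_of_subset_of_card_le hsub' (by omega)
  have hcards : #(G.nonCut S') = #(G.nonCut S) := le_antisymm (by
    rw [heq]; omega) hmin
  have hRS : R ⊆ G.nonCut S := sdiff_subset.trans (erase_subset _ _)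
  have hdisj : Disjoint R (P.image p) := by
    rw [Finset.disjoint_left]
    intro y hy hy'
    exact hpS y hy' (hnS (hRS hy))
  have hns : G.nonCut S = insert w (P ∪ R) := by
    rw [hR, union_sdiff_of_subset hPe, insert_erase hw]
  have hdisj2 : Disjoint P R := disjoint_sdiff
  have hw2 : w ∉ P ∪ R := by simp [hwP, hR]
  set n := Fintype.card V with hn
  have hhn : ∀ y ∈ S, h y < n := fun y hy =>
    (H.isRooted.lt_card hy).trans_le (card_le_univ S)
  have hWS : G.nonCutWeight S h = 4 ^ (n - h w) + (∑ u ∈ P, 4 ^ (n - h u) +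
      ∑ y ∈ R, 4 ^ (n - h y)) := by
    rw [nonCutWeight, hns, sum_insert hw2, sum_union hdisj2]
  have hWS' : ∀ h' : V → ℕ, G.nonCutWeight S' h' = 4 ^ (n - h' x) +
      (∑ y ∈ R, 4 ^ (n - h' y) + ∑ u ∈ P, 4 ^ (n - h' (p u))) := by
    intro h'
    rw [nonCutWeight, heq, sum_insert hxR, sum_union hdisj, sum_image hinj]
  by_cases hwr : w = r
  · subst hwr
    have hh1 : ∀ y ∈ S, y ≠ w → 1 ≤ h y := fun y hy hyw => by
      obtain ⟨z, -, -, hz⟩ := H.isRooted.2.2 y hy hyw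
      omega
    have hx1 : h x = 1 := by
      obtain ⟨z, hz, hxz, hzh⟩ := H.isRooted.2.2 x hxS0 hxnw
      by_contra hne
      -- Descending from `x` ends at a vertex of height `1` adjacent to the root `w`; since `x` is
      -- the only neighbour of `w`, that vertex is `x`.
      have key : ∀ m, ∀ y ∈ S, y ≠ w → h y = m + 1 → ∃ y' ∈ S, h y' = 1 ∧ G.Adj y' w := by
        intro m
        induction m with
        | zero =>
          intro y hy hyw hy1
          obtain ⟨z, hz, hyz, hzh⟩ := H.isRooted.2.2 y hy hyw
          have : z = w := by
            by_contra hzw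
            have := hh1 z hz hzw
            omega
          exact ⟨y, hy, hy1, this ▸ hyz⟩
        | succ m ih =>
          intro y hy hyw hy1
          obtain ⟨z, hz, hyz, hzh⟩ := H.isRooted.2.2 y hy hyw
          refine ih z hz ?_ (by omega)
          rintro rfl
          rw [H.isRooted.2.1] at hzh
          omega
      obtain ⟨y', hy', hy1, hyw⟩ := key (h x - 1) x hxS0 hxnw
        (by have := hh1 x hxS0 hxnw; omega)
      rw [hxw y' hy' hyw.symm] at hy1
      exact hne hy1
    -- When the root itself is removed, `x` becomes the root and every height drops by one. Then `x`
    -- replaces `w` and each `p u` replaces `u` at equal weight, while the weight of `R` is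
    -- multiplied by `4`.
    have hroot : G.IsRooted (S.erase w) x (fun y => h y - 1) := by
      refine ⟨hxS, by simp [hx1], fun y hy hyx => ?_⟩
      obtain ⟨hyw, hyS⟩ := mem_erase.1 hy
      obtain ⟨z, hz, hyz, hzh⟩ := H.isRooted.2.2 y hyS hyw
      have hzw : z ≠ w := by
        rintro rfl
        exact hyx (hxw y hyS hyz.symm)
      refine ⟨z, mem_erase.2 ⟨hzw, hz⟩, hyz, ?_⟩
      have := hh1 z hz hzw
      have := hh1 y hyS hyw
      show h z - 1 + 1 = h y - 1
      omega
    obtain ⟨h', hr', hh', hhp'⟩ := hroot.union_image hP' hp'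
    obtain ⟨ho1, ho2⟩ := H.weight_le S' x h' hr' hd' hcards
    have e1 : 4 ^ (n - h' x) = 4 ^ (n - h w) := by
      rw [hh' x hxS, hx1, H.isRooted.2.1]
    have e2 : ∑ u ∈ P, 4 ^ (n - h' (p u)) = ∑ u ∈ P, 4 ^ (n - h u) :=
      sum_congr rfl fun u hu => by
        have h1 := hh1 u (hnS (hPn hu)) (fun e => hwP (e ▸ hu))
        rw [hhp' u hu]
        congr 2
        show h u - 1 + 1 = h u
        omega
    have e3 : ∑ y ∈ R, 4 ^ (n - h' y) = 4 * ∑ y ∈ R, 4 ^ (n - h y) := by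
      rw [mul_sum]
      refine sum_congr rfl fun y hy => ?_
      have hyw : y ≠ w := fun e => hw2 (e ▸ mem_union_right _ hy)
      have hyS := hnS (hRS hy)
      have h1 := hh1 y hyS hyw
      have h2 := hhn y hyS
      rw [hh' y (mem_erase.2 ⟨hyw, hyS⟩), ← pow_succ']
      congr 1
      show n - (h y - 1) = n - h y + 1
      omega
    rw [hWS, hWS' h', e1, e2, e3] at ho1 ho2
    -- Maximality of the weight forces `R` to be empty, so `#P = 2`. Now the weights tie, but `S'`
    -- has one vertex more than `S`.
    have hR0 : ∑ y ∈ R, 4 ^ (n - h y) = 0 := by omega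
    have hRe : R = ∅ := by
      by_contra hne
      obtain ⟨y, hy⟩ := nonempty_iff_ne_empty.2 hne
      have := (sum_eq_zero_iff.1 hR0) y hy
      simp at this
    rw [hRe, card_empty] at hcardR
    have hdS : Disjoint (S.erase w) (P.image p) := by
      rw [Finset.disjoint_left]
      intro y hy hy'
      exact hpS y hy' (mem_of_mem_erase hy)
    have hcS' : #S' = #S - 1 + #P := by rw [hS', card_union_of_disjoint hdS, herase, hcardp]
    have := ho2 (by rw [hR0]; omega)
    omega
  · have hxh : h x + 1 = h w := by
      obtain ⟨z, hz, hwz, hzh⟩ := H.isRooted.2.2 w hwS hwr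
      rwa [hxw z hz hwz] at hzh
    have hroot : G.IsRooted (S.erase w) r h := by
      refine ⟨mem_erase.2 ⟨Ne.symm hwr, H.isRooted.1⟩, H.isRooted.2.1, fun y hy hyr => ?_⟩
      obtain ⟨hyw, hyS⟩ := mem_erase.1 hy
      obtain ⟨z, hz, hyz, hzh⟩ := H.isRooted.2.2 y hyS hyr
      refine ⟨z, mem_erase.2 ⟨?_, hz⟩, hyz, hzh⟩
      rintro rfl
      rw [hxw y hyS hyz.symm] at hzh
      omega
    obtain ⟨h', hr', hh', hhp'⟩ := hroot.union_image hP' hp'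
    obtain ⟨ho1, -⟩ := H.weight_le S' r h' hr' hd' hcards
    -- The base `4` is chosen for this comparison: `x`, one lower than `w`, gains four units `4 ^ (n
    -- - h w)`, whereas losing `w` and at most two vertices no lower than `w` costs at most three.
    have e1 : 4 ^ (n - h' x) = 4 * 4 ^ (n - h w) := by
      have := hhn w hwS
      rw [hh' x hxS, ← pow_succ']
      congr 1
      omega
    have e3 : ∑ y ∈ R, 4 ^ (n - h' y) = ∑ y ∈ R, 4 ^ (n - h y) :=
      sum_congr rfl fun y hy => by
        rw [hh' y (mem_erase.2 ⟨fun e => hw2 (e ▸ mem_union_right _ hy), hnS (hRS hy)⟩)]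
    have e2 : ∑ u ∈ P, 4 ^ (n - h u) ≤ 2 * 4 ^ (n - h w) :=
      calc ∑ u ∈ P, 4 ^ (n - h u) ≤ ∑ _u ∈ P, 4 ^ (n - h w) :=
            sum_le_sum fun u hu => Nat.pow_le_pow_right (by norm_num)
              (Nat.sub_le_sub_left (hhP u hu) _)
        _ = #P * 4 ^ (n - h w) := by simp
        _ ≤ 2 * 4 ^ (n - h w) := Nat.mul_le_mul_right _ hP2
    have e4 : 0 < 4 ^ (n - h w) := by positivity
    rw [hWS, hWS' h', e1, e3] at ho1
    omega

/-- The private neighbours are found greedily from the highest vertex down, so that the exchange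
always removes a vertex no higher than those receiving pendant vertices. A failure at `a`, `b` or
`c` is an exchange with `P` equal to `∅`, `{a}` or `{a, b}`. -/
lemma IsOptimal.exists_private_of_le {S : Finset V} {r : V} {h : V → ℕ}
    (H : G.IsOptimal S r h) {a b c : V} (ha : a ∈ G.nonCut S) (hb : b ∈ G.nonCut S)
    (hc : c ∈ G.nonCut S) (hab : a ≠ b) (hac : a ≠ c) (hbc : b ≠ c) (h1 : h b ≤ h a)
    (h2 : h c ≤ h b) : ∃ p q s, G.IsPrivate S a p ∧ G.IsPrivate S b q ∧ G.IsPrivate S c s ∧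
      ¬ G.Adj p q ∧ ¬ G.Adj p s ∧ ¬ G.Adj q s := by
  have h3 : 3 ≤ #(G.nonCut S) := by
    have : #({a, b, c} : Finset V) = 3 := card_eq_three.2 ⟨a, b, c, hab, hac, hbc, rfl⟩
    rw [← this]
    exact card_le_card (by simp [insert_subset_iff, ha, hb, hc])
  obtain ⟨p, hp⟩ : ∃ p, G.IsPrivate S a p := by
    by_contra! hcon
    exact H.exchange_false (P := ∅) (p := id) h3 ha (by simp) (by simp) (by simp) (by simp)
      (by simp) (by simp) fun z hz => absurd hz (hcon z)
  obtain ⟨q, hq, hpq⟩ : ∃ q, G.IsPrivate S b q ∧ ¬ G.Adj p q := by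
    by_contra! hcon
    exact H.exchange_false (P := {a}) (p := fun _ => p) h3 hb (by simpa using ha)
      (by simpa using hab.symm) (by simp) (by simpa using h1) (by simpa using hp)
      (by simp) fun z hz => ⟨a, by simp, (hcon z hz).symm⟩
  obtain ⟨s, hs, hps, hqs⟩ : ∃ s, G.IsPrivate S c s ∧ ¬ G.Adj p s ∧ ¬ G.Adj q s := by
    by_contra! hcon
    refine H.exchange_false (P := {a, b}) (p := fun x => if x = a then p else q) h3 hc
      (by simp [insert_subset_iff, ha, hb]) (by simp [hac.symm, hbc.symm])
      (card_le_two) (by simp [h2, h2.trans h1]) (by simp [hp, hq, hab.symm])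
      (by simp [hab.symm, hpq, G.adj_comm q p]) fun z hz => ?_
    by_cases hpz : G.Adj p z
    · exact ⟨a, by simp, by simpa using hpz.symm⟩
    · exact ⟨b, by simp, by simpa [hab.symm] using (hcon z hz hpz).symm⟩
  exact ⟨p, q, s, hp, hq, hs, hpq, hps, hqs⟩

lemma IsOptimal.exists_private {S : Finset V} {r : V} {h : V → ℕ}
    (H : G.IsOptimal S r h) {a b c : V} (ha : a ∈ G.nonCut S) (hb : b ∈ G.nonCut S)
    (hc : c ∈ G.nonCut S) (hab : a ≠ b) (hac : a ≠ c) (hbc : b ≠ c) :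
    ∃ p q s, G.IsPrivate S a p ∧ G.IsPrivate S b q ∧ G.IsPrivate S c s ∧
      ¬ G.Adj p q ∧ ¬ G.Adj p s ∧ ¬ G.Adj q s := by
  have key := @IsOptimal.exists_private_of_le V G _ S r h H
  rcases le_total (h a) (h b) with h1 | h1 <;> rcases le_total (h b) (h c) with h2 | h2 <;>
    rcases le_total (h a) (h c) with h4 | h4
  · obtain ⟨s, q, p, hs, hq, hp, h5, h6, h7⟩ :=
      key hc hb ha hbc.symm hac.symm hab.symm h2 h1
    exact ⟨p, q, s, hp, hq, hs, fun e => h7 e.symm, fun e => h6 e.symm, fun e => h5 e.symm⟩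
  · obtain ⟨s, q, p, hs, hq, hp, h5, h6, h7⟩ :=
      key hc hb ha hbc.symm hac.symm hab.symm h2 h1
    exact ⟨p, q, s, hp, hq, hs, fun e => h7 e.symm, fun e => h6 e.symm, fun e => h5 e.symm⟩
  · obtain ⟨q, s, p, hq, hs, hp, h5, h6, h7⟩ :=
      key hb hc ha hbc hab.symm hac.symm h2 h4
    exact ⟨p, q, s, hp, hq, hs, fun e => h6 e.symm, fun e => h7 e.symm, h5⟩
  · obtain ⟨q, p, s, hq, hp, hs, h5, h6, h7⟩ :=
      key hb ha hc hab.symm hbc hac h1 h4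
    exact ⟨p, q, s, hp, hq, hs, fun e => h5 e.symm, h7, h6⟩
  · obtain ⟨s, p, q, hs, hp, hq, h5, h6, h7⟩ :=
      key hc ha hb hac.symm hbc.symm hab h4 h1
    exact ⟨p, q, s, hp, hq, hs, h7, fun e => h5 e.symm, fun e => h6 e.symm⟩
  · obtain ⟨p, s, q, hp, hs, hq, h5, h6, h7⟩ :=
      key ha hc hb hac hab hbc.symm h4 h2
    exact ⟨p, q, s, hp, hq, hs, h6, h5, fun e => h7 e.symm⟩
  · obtain ⟨p, q, s, hp, hq, hs, h5, h6, h7⟩ :=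
      key ha hb hc hab hac hbc h1 h2
    exact ⟨p, q, s, hp, hq, hs, h5, h6, h7⟩
  · obtain ⟨p, q, s, hp, hq, hs, h5, h6, h7⟩ :=
      key ha hb hc hab hac hbc h1 h2
    exact ⟨p, q, s, hp, hq, hs, h5, h6, h7⟩

end SimpleGraph

namespace SimpleGraph

open Finset Classical

variable {V : Type*} {G : SimpleGraph V}

/-! ### Private triples and the lengthening of claws and nets -/

/-- Any three vertices of `S` that are not cut vertices have pairwise nonadjacent private
neighbours. -/
def HasPrivateTriples (G : SimpleGraph V) (S : Finset V) : Prop :=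
  ∀ a ∈ G.nonCut S, ∀ b ∈ G.nonCut S, ∀ c ∈ G.nonCut S, a ≠ b → a ≠ c → b ≠ c →
    ∃ p q s, G.IsPrivate S a p ∧ G.IsPrivate S b q ∧ G.IsPrivate S c s ∧
      ¬ G.Adj p q ∧ ¬ G.Adj p s ∧ ¬ G.Adj q s

lemma exists_hasPrivateTriples [Fintype V] (hG : G.IsConnOn univ) :
    ∃ S, G.IsConnOn S ∧ G.IsDominatingSet S ∧ G.HasPrivateTriples S := by
  obtain ⟨S, r, h, H⟩ := exists_isOptimal hG
  exact ⟨S, H.isRooted.isConnOn, H.isDominatingSet,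
    fun a ha b hb c hc hab hac hbc => H.exists_private ha hb hc hab hac hbc⟩

/-- A vertex of a connected subset `T` of `S` that is not a cut vertex of `T` is not a cut vertex
of `S`, or part of `S` hangs on it outside `T`. -/
lemma IsConnOn.mem_nonCut_or_exists {S T : Finset V} {f : V}
    (hTS : T ⊆ S) (hf : f ∈ T) (hT : G.IsConnOn (T.erase f)) :
    f ∈ G.nonCut S ∨ ∃ A ⊆ S, A.Nonempty ∧ (∀ a ∈ A, a ∉ T) ∧
      ∀ a ∈ A, ∀ b ∈ S, G.Adj a b → b ∈ A ∨ b = f := by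
  by_cases hn : f ∈ G.nonCut S
  · exact Or.inl hn
  right
  have hne : (S.erase f).Nonempty := hT.1.mono (erase_subset_erase _ hTS)
  have h1 : ¬ G.IsConnOn (S.erase f) := fun h => hn (mem_nonCut.2 ⟨hTS hf, h⟩)
  simp only [IsConnOn, hne, true_and] at h1
  push Not at h1
  obtain ⟨A, ⟨a, haA, haS⟩, hcl, b, hbS, hbA⟩ := h1
  -- `T` minus `f` is connected, so it lies on one side of the separation of `S` minus `f`; the
  -- other side hangs on `f`.
  by_cases hTA : ∃ t ∈ A, t ∈ T.erase f
  · have h2 := hT.2 A hTA fun x hx hxT y hy hxy =>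
      hcl x hx (erase_subset_erase _ hTS hxT) y (erase_subset_erase _ hTS hy) hxy
    refine ⟨(S.erase f).filter (· ∉ A), (filter_subset _ _).trans (erase_subset _ _),
      ⟨b, mem_filter.2 ⟨hbS, hbA⟩⟩, fun x hx hxT => ?_, fun x hx y hy hxy => ?_⟩
    · obtain ⟨hxS, hxA⟩ := mem_filter.1 hx
      exact hxA (h2 x (mem_erase.2 ⟨(mem_erase.1 hxS).1, hxT⟩))
    · obtain ⟨hxS, hxA⟩ := mem_filter.1 hx
      by_cases hyf : y = f
      · exact Or.inr hyf
      · refine Or.inl (mem_filter.2 ⟨mem_erase.2 ⟨hyf, hy⟩, fun hyA => hxA ?_⟩)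
        exact hcl y hyA (mem_erase.2 ⟨hyf, hy⟩) x hxS hxy.symm
  · refine ⟨(S.erase f).filter (· ∈ A), (filter_subset _ _).trans (erase_subset _ _),
      ⟨a, mem_filter.2 ⟨haS, haA⟩⟩, fun x hx hxT => ?_, fun x hx y hy hxy => ?_⟩
    · obtain ⟨hxS, hxA⟩ := mem_filter.1 hx
      exact hTA ⟨x, hxA, mem_erase.2 ⟨(mem_erase.1 hxS).1, hxT⟩⟩
    · obtain ⟨hxS, hxA⟩ := mem_filter.1 hx
      by_cases hyf : y = f
      · exact Or.inr hyf
      · exact Or.inl (mem_filter.2 ⟨mem_erase.2 ⟨hyf, hy⟩,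
          hcl x hxA hxS y (mem_erase.2 ⟨hyf, hy⟩) hxy⟩)

/-- A connected subset `T` of `S` can be extended by three pairwise nonadjacent vertices that hang
on three given vertices of `T`, none of which is a cut vertex of `T`. -/
lemma IsConnOn.exists_extension {S T : Finset V} (hS : G.IsConnOn S)
    (hpriv : G.HasPrivateTriples S) (hTS : T ⊆ S) {f : Fin 3 → V} (hf : Function.Injective f)
    (hfT : ∀ i, f i ∈ T) (hfc : ∀ i, G.IsConnOn (T.erase (f i))) :
    ∃ t : Fin 3 → V, (∀ i, G.IsPrivate T (f i) (t i)) ∧ ∀ i j, ¬ G.Adj (t i) (t j) := by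
  -- `A i` is the part of `S` hanging on `f i`, or empty, and `u i` is a non-cut vertex of `S` found
  -- in it, or `f i` itself. The private triple is requested for the `u i`.
  have key : ∀ i, ∃ A ⊆ S, ∃ u ∈ G.nonCut S, (∀ a ∈ A, a ∉ T) ∧
      (∀ a ∈ A, ∀ b ∈ S, G.Adj a b → b ∈ A ∨ b = f i) ∧
      ((u = f i ∧ A = ∅) ∨ (u ∈ A ∧ ∃ t ∈ A, G.Adj t (f i))) := by
    intro i
    rcases mem_nonCut_or_exists hTS (hfT i) (hfc i) with h | ⟨A, hAS, hA, hAT, hcl⟩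
    · exact ⟨∅, by simp, f i, h, by simp, by simp, by simp⟩
    · have hfA : f i ∉ A := fun h => hAT _ h (hfT i)
      obtain ⟨u, huA, hu⟩ := hS.exists_mem_nonCut (hTS (hfT i)) hAS hA hfA hcl
      obtain ⟨t, ht, b, hb, hbA, htb⟩ := hS.exists_adj_of_ne hA hAS
        (fun e => hfA (e ▸ hTS (hfT i)))
      refine ⟨A, hAS, u, hu, hAT, hcl, Or.inr ⟨huA, t, ht, ?_⟩⟩
      rwa [← (hcl t ht b hb htb).resolve_left hbA]
  choose A hAS u hu hAT hcl hor using key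
  have hdisj : ∀ i j, i ≠ j → ∀ x ∈ A i, x ∉ A j := by
    intro i j hij x hxi hxj
    -- The intersection is closed under adjacency in `S`, because its two possible exits `f i` and
    -- `f j` differ. If nonempty it would be all of `S` and contain `f i`.
    have := hS.2 {y | y ∈ A i ∧ y ∈ A j} ⟨x, ⟨hxi, hxj⟩, hAS i hxi⟩ (fun a ha _ b hb hab => by
      rcases hcl i a ha.1 b hb hab with h1 | rfl
      · rcases hcl j a ha.2 b hb hab with h2 | rfl
        · exact ⟨h1, h2⟩
        · exact absurd (hfT j) (hAT i _ h1)
      · rcases hcl j a ha.2 _ hb hab with h2 | h2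
        · exact absurd (hfT i) (hAT j _ h2)
        · exact absurd (hf h2) hij) (f i) (hTS (hfT i))
    exact hAT i _ this.1 (hfT i)
  have huinj : ∀ i j, i ≠ j → u i ≠ u j := by
    intro i j hij e
    rcases hor i with ⟨h1, -⟩ | ⟨h1, -⟩ <;> rcases hor j with ⟨h2, -⟩ | ⟨h2, -⟩
    · exact hij (hf (h1.symm.trans (e.trans h2)))
    · exact hAT j _ h2 (e ▸ h1.symm ▸ hfT i)
    · exact hAT i _ h1 (e.symm ▸ h2.symm ▸ hfT j)
    · exact hdisj i j hij _ h1 (e.symm ▸ h2)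
  obtain ⟨p0, p1, p2, hp0, hp1, hp2, h01, h02, h12⟩ := hpriv _ (hu 0) _ (hu 1) _ (hu 2)
    (huinj 0 1 (by decide)) (huinj 0 2 (by decide)) (huinj 1 2 (by decide))
  obtain ⟨p, hp, hpp⟩ : ∃ p : Fin 3 → V, (∀ i, G.IsPrivate S (u i) (p i)) ∧
      ∀ i j, ¬ G.Adj (p i) (p j) := by
    refine ⟨![p0, p1, p2], ?_, ?_⟩
    · intro i
      fin_cases i
      exacts [hp0, hp1, hp2]
    · intro i j
      fin_cases i <;> fin_cases j <;> simp [h01, h02, h12, G.adj_comm p1 p0, G.adj_comm p2 p0,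
        G.adj_comm p2 p1]
  -- The new end is the private neighbour when `f i` is a non-cut vertex, and otherwise a neighbour
  -- of `f i` in the part hanging on it.
  have ht : ∀ i, ∃ t, (t = p i ∧ u i = f i) ∨ (t ∈ A i ∧ G.Adj t (f i)) := by
    intro i
    rcases hor i with ⟨h1, -⟩ | ⟨-, t, h1, h2⟩
    · exact ⟨p i, Or.inl ⟨rfl, h1⟩⟩
    · exact ⟨t, Or.inr ⟨h1, h2⟩⟩
  choose t ht using ht
  have hmix : ∀ i j, u j = f j → t i ∈ A i → ¬ G.Adj (p j) (t i) := by
    intro i j hj hi hadj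
    have h1 := ((hp j).2 (t i) (hAS i hi)).1 hadj
    exact hAT i _ hi (h1 ▸ hj.symm ▸ hfT j)
  refine ⟨t, fun i => ?_, fun i j => ?_⟩
  · rcases ht i with ⟨h1, h2⟩ | ⟨h1, h2⟩
    · rw [h1, ← h2]
      exact (hp i).mono hTS
    · refine ⟨hAT i _ h1, fun y hy => ⟨fun hty => ?_, fun e => e ▸ h2⟩⟩
      exact (hcl i _ h1 y (hTS hy) hty).resolve_left fun h => hAT i _ h hy
  · by_cases hij : i = j
    · subst hij
      exact G.irrefl
    rcases ht i with ⟨h1, h2⟩ | ⟨h1, h2⟩ <;> rcases ht j with ⟨h3, h4⟩ | ⟨h3, h4⟩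
    · rw [h1, h3]
      exact hpp i j
    · rw [h1]
      exact hmix j i h2 h3
    · rw [h3]
      exact fun e => hmix i j h4 h1 e.symm
    · intro hadj
      rcases hcl i _ h1 _ (hAS j h3) hadj with h5 | h5
      · exact hdisj i j hij _ h5 h3
      · exact hAT j _ h3 (h5 ▸ hfT i)

lemma IsConnOn.image {W : Type*} {F : SimpleGraph W} {T : Finset W} (hT : F.IsConnOn T)
    (f : F ↪g G) : G.IsConnOn (T.image f) := by
  refine ⟨hT.1.image f, ?_⟩
  rintro A ⟨a, haA, haT⟩ hcl b hb
  obtain ⟨x, hx, rfl⟩ := mem_image.1 haT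
  obtain ⟨y, hy, rfl⟩ := mem_image.1 hb
  exact hT.2 (f ⁻¹' A) ⟨x, haA, hx⟩ (fun v hv hvT w hw hvw => hcl _ hv (mem_image_of_mem _ hvT) _
    (mem_image_of_mem _ hw) (f.map_adj_iff.2 hvw)) y hy

lemma IsConnOn.exists_extension_embedding {W : Type*} [Fintype W] {F : SimpleGraph W}
    {S : Finset V} (hS : G.IsConnOn S) (hpriv : G.HasPrivateTriples S) (f : F ↪g G)
    (hfS : ∀ x, f x ∈ S) {l : Fin 3 → W} (hl : Function.Injective l)
    (hlc : ∀ i, F.IsConnOn (univ.erase (l i))) :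
    ∃ t : Fin 3 → V, (∀ i x, t i ≠ f x) ∧ (∀ i x, G.Adj (t i) (f x) ↔ x = l i) ∧
      ∀ i j, ¬ G.Adj (t i) (t j) := by
  obtain ⟨t, ht, htt⟩ := hS.exists_extension hpriv (T := univ.image f) (f := fun i => f (l i))
    (by simpa [image_subset_iff] using hfS) (f.injective.comp hl)
    (fun i => mem_image_of_mem _ (mem_univ _)) (fun i => by
      rw [← image_erase f.injective]
      exact (hlc i).image f)
  refine ⟨t, fun i x e => (ht i).1 (e ▸ mem_image_of_mem _ (mem_univ _)), fun i x => ?_, htt⟩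
  rw [(ht i).2 _ (mem_image_of_mem _ (mem_univ _))]
  exact f.injective.eq_iff

lemma isConnOn_subdividedClaw (k : ℕ) : (subdividedClaw k).IsConnOn univ := by
  refine IsRooted.isConnOn (r := none) (h := fun x => x.elim 0 fun y => y.2.val + 1)
    ⟨mem_univ _, rfl, ?_⟩
  rintro (_ | ⟨i, a, ha⟩) - h
  · exact absurd rfl h
  · rcases a with _ | a
    · exact ⟨none, mem_univ _, rfl, rfl⟩
    · exact ⟨some (i, ⟨a, by omega⟩), mem_univ _, ⟨rfl, Or.inr rfl⟩, rfl⟩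

lemma isConnOn_subdividedClaw_erase (m : ℕ) (i : Fin 3) :
    (subdividedClaw (m + 1)).IsConnOn (univ.erase (some (i, Fin.last m))) := by
  refine IsRooted.isConnOn (r := none) (h := fun x => x.elim 0 fun y => y.2.val + 1)
    ⟨by simp, rfl, ?_⟩
  rintro (_ | ⟨j, a, ha⟩) - h
  · exact absurd rfl h
  · rcases a with _ | a
    · exact ⟨none, by simp, rfl, rfl⟩
    · refine ⟨some (j, ⟨a, by omega⟩), ?_, ⟨rfl, Or.inr rfl⟩, rfl⟩
      simp only [mem_erase, ne_eq, Option.some.injEq, Prod.mk.injEq, Fin.ext_iff, Fin.val_last,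
        mem_univ, and_true]
      omega

lemma isConnOn_subdividedNet (k : ℕ) : (subdividedNet k).IsConnOn univ := by
  refine IsRooted.isConnOn (r := (0, 0)) (h := fun x => if x.1 = 0 then x.2.val else x.2.val + 1)
    ⟨mem_univ _, rfl, ?_⟩
  rintro ⟨i, a, ha⟩ - h
  rcases a with _ | a
  · have hi : i ≠ 0 := fun e => h (by rw [e]; rfl)
    exact ⟨(0, 0), mem_univ _, Or.inr ⟨hi, rfl, rfl⟩, by simp [hi]⟩
  · exact ⟨(i, ⟨a, by omega⟩), mem_univ _, Or.inl ⟨rfl, Or.inr rfl⟩, by dsimp; split_ifs <;> rfl⟩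

lemma isConnOn_subdividedNet_erase (m : ℕ) (i : Fin 3) :
    (subdividedNet m).IsConnOn (univ.erase (i, Fin.last m)) := by
  -- For `m = 0` the deleted leaf is a vertex of the triangle, so the root is taken on another leg.
  obtain ⟨j, hji⟩ : ∃ j : Fin 3, j ≠ i := exists_ne i
  refine IsRooted.isConnOn (r := (j, 0)) (h := fun x => if x.1 = j then x.2.val else x.2.val + 1)
    ⟨by simp [hji], by simp, ?_⟩
  rintro ⟨l, a, ha⟩ - h
  rcases a with _ | a
  · have hi : l ≠ j := fun e => h (by rw [e]; rfl)
    exact ⟨(j, 0), by simp [hji], Or.inr ⟨hi, rfl, rfl⟩, by simp [hi]⟩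
  · refine ⟨(l, ⟨a, by omega⟩), ?_, Or.inl ⟨rfl, Or.inr rfl⟩, by dsimp; split_ifs <;> rfl⟩
    simp only [mem_erase, ne_eq, Prod.mk.injEq, Fin.ext_iff, Fin.val_last, mem_univ, and_true]
    omega

lemma subdividedClaw_succ_isIndContained {m : ℕ} (f : subdividedClaw (m + 1) ↪g G)
    {t : Fin 3 → V} (h1 : ∀ i x, t i ≠ f x)
    (h2 : ∀ i x, G.Adj (t i) (f x) ↔ x = some (i, Fin.last m))
    (h3 : ∀ i j, ¬ G.Adj (t i) (t j)) : (subdividedClaw (m + 2)).IsIndContained G := by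
  have ht : ∀ i j, t i = t j → i = j := fun i j e => by
    have := (h2 i (some (i, Fin.last m))).2 rfl
    rw [e, h2] at this
    simpa using this
  let g : Option (Fin 3 × Fin (m + 2)) → V := fun x => match x with
    | none => f none
    | some (i, a) => if h : a.val < m + 1 then f (some (i, ⟨a.val, h⟩)) else t i
  have hg1 : ∀ i (a : Fin (m + 2)) (h : a.val < m + 1), g (some (i, a)) = f (some (i, ⟨a, h⟩)) :=
    fun i a h => dif_pos h
  have hg2 : ∀ i (a : Fin (m + 2)), ¬ a.val < m + 1 → g (some (i, a)) = t i :=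
    fun i a h => dif_neg h
  refine ⟨⟨⟨g, ?_⟩, ?_⟩⟩
  · rintro (_ | ⟨i, a⟩) (_ | ⟨j, b⟩) h
    · rfl
    · by_cases hb : b.val < m + 1
      · rw [hg1 j b hb] at h
        simpa using f.injective h
      · rw [hg2 j b hb] at h
        exact absurd h.symm (h1 _ _)
    · by_cases hb : a.val < m + 1
      · rw [hg1 i a hb] at h
        simpa using f.injective h
      · rw [hg2 i a hb] at h
        exact absurd h (h1 _ _)
    · by_cases ha : a.val < m + 1 <;> by_cases hb : b.val < m + 1
      · rw [hg1 i a ha, hg1 j b hb] at h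
        have := f.injective h
        simp only [Option.some.injEq, Prod.mk.injEq, Fin.mk.injEq] at this
        simp [this.1, Fin.ext_iff, this.2]
      · rw [hg1 i a ha, hg2 j b hb] at h
        exact absurd h.symm (h1 _ _)
      · rw [hg2 i a ha, hg1 j b hb] at h
        exact absurd h (h1 _ _)
      · rw [hg2 i a ha, hg2 j b hb] at h
        simp only [Option.some.injEq, Prod.mk.injEq, Fin.ext_iff]
        exact ⟨Fin.ext_iff.1 (ht i j h), by omega⟩
  · rintro (_ | ⟨i, a⟩) (_ | ⟨j, b⟩)
    · simp
    · show G.Adj (g none) (g (some (j, b))) ↔ b.val = 0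
      by_cases hb : b.val < m + 1
      · rw [hg1 j b hb]
        exact f.map_adj_iff
      · rw [hg2 j b hb, G.adj_comm, h2]
        simp only [reduceCtorEq, false_iff]
        omega
    · show G.Adj (g (some (i, a))) (g none) ↔ a.val = 0
      by_cases hb : a.val < m + 1
      · rw [hg1 i a hb]
        exact f.map_adj_iff
      · rw [hg2 i a hb, h2]
        simp only [reduceCtorEq, false_iff]
        omega
    · show G.Adj (g (some (i, a))) (g (some (j, b))) ↔
        i = j ∧ (a.val + 1 = b.val ∨ b.val + 1 = a.val)
      by_cases ha : a.val < m + 1 <;> by_cases hb : b.val < m + 1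
      · rw [hg1 i a ha, hg1 j b hb]
        exact f.map_adj_iff
      · rw [hg1 i a ha, hg2 j b hb, G.adj_comm, h2]
        simp only [Option.some.injEq, Prod.mk.injEq, Fin.ext_iff, Fin.val_last]
        omega
      · rw [hg2 i a ha, hg1 j b hb, h2]
        simp only [Option.some.injEq, Prod.mk.injEq, Fin.ext_iff, Fin.val_last]
        omega
      · rw [hg2 i a ha, hg2 j b hb]
        simp only [h3, false_iff]
        omega

lemma subdividedNet_succ_isIndContained {m : ℕ} (f : subdividedNet m ↪g G)
    {t : Fin 3 → V} (h1 : ∀ i x, t i ≠ f x)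
    (h2 : ∀ i x, G.Adj (t i) (f x) ↔ x = (i, Fin.last m))
    (h3 : ∀ i j, ¬ G.Adj (t i) (t j)) : (subdividedNet (m + 1)).IsIndContained G := by
  have ht : ∀ i j, t i = t j → i = j := fun i j e => by
    have := (h2 i (i, Fin.last m)).2 rfl
    rw [e, h2] at this
    simpa using this
  let g : Fin 3 × Fin (m + 2) → V := fun x =>
    if h : x.2.val < m + 1 then f (x.1, ⟨x.2.val, h⟩) else t x.1
  have hg1 : ∀ i (a : Fin (m + 2)) (h : a.val < m + 1), g (i, a) = f (i, ⟨a, h⟩) :=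
    fun i a h => dif_pos h
  have hg2 : ∀ i (a : Fin (m + 2)), ¬ a.val < m + 1 → g (i, a) = t i :=
    fun i a h => dif_neg h
  refine ⟨⟨⟨g, ?_⟩, ?_⟩⟩
  · rintro ⟨i, a⟩ ⟨j, b⟩ h
    by_cases ha : a.val < m + 1 <;> by_cases hb : b.val < m + 1
    · rw [hg1 i a ha, hg1 j b hb] at h
      have := f.injective h
      simp only [Prod.mk.injEq, Fin.mk.injEq] at this
      simp [this.1, Fin.ext_iff, this.2]
    · rw [hg1 i a ha, hg2 j b hb] at h
      exact absurd h.symm (h1 _ _)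
    · rw [hg2 i a ha, hg1 j b hb] at h
      exact absurd h (h1 _ _)
    · rw [hg2 i a ha, hg2 j b hb] at h
      simp only [Prod.mk.injEq, Fin.ext_iff]
      exact ⟨Fin.ext_iff.1 (ht i j h), by omega⟩
  · rintro ⟨i, a⟩ ⟨j, b⟩
    show G.Adj (g (i, a)) (g (j, b)) ↔ (i = j ∧ (a.val + 1 = b.val ∨ b.val + 1 = a.val)) ∨
      (i ≠ j ∧ a.val = 0 ∧ b.val = 0)
    by_cases ha : a.val < m + 1 <;> by_cases hb : b.val < m + 1
    · rw [hg1 i a ha, hg1 j b hb]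
      exact f.map_adj_iff
    · rw [hg1 i a ha, hg2 j b hb, G.adj_comm, h2]
      simp only [Prod.mk.injEq, Fin.ext_iff, Fin.val_last]
      omega
    · rw [hg2 i a ha, hg1 j b hb, h2]
      simp only [Prod.mk.injEq, Fin.ext_iff, Fin.val_last]
      omega
    · rw [hg2 i a ha, hg2 j b hb]
      simp only [h3, false_iff]
      omega

lemma IsConnOn.subdividedClaw_succ {S : Finset V} (hS : G.IsConnOn S)
    (hpriv : G.HasPrivateTriples S) {m : ℕ} (f : subdividedClaw (m + 1) ↪g G)
    (hf : ∀ x, f x ∈ S) : (subdividedClaw (m + 2)).IsIndContained G := by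
  obtain ⟨t, h1, h2, h3⟩ := hS.exists_extension_embedding hpriv f hf
    (l := fun i => some (i, Fin.last m)) (fun i j h => by simpa using h)
    (fun i => by convert isConnOn_subdividedClaw_erase m i)
  exact subdividedClaw_succ_isIndContained f h1 h2 h3

lemma IsConnOn.subdividedNet_succ {S : Finset V} (hS : G.IsConnOn S)
    (hpriv : G.HasPrivateTriples S) {m : ℕ} (f : subdividedNet m ↪g G)
    (hf : ∀ x, f x ∈ S) : (subdividedNet (m + 1)).IsIndContained G := by
  obtain ⟨t, h1, h2, h3⟩ := hS.exists_extension_embedding hpriv f hf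
    (l := fun i => (i, Fin.last m)) (fun i j h => by simpa using h)
    (fun i => by convert isConnOn_subdividedNet_erase m i)
  exact subdividedNet_succ_isIndContained f h1 h2 h3

/-! ### Hamiltonian paths in graphs without induced claws and nets -/

/-- Among any three neighbours of a vertex, two are adjacent. -/
def IsClawFree (G : SimpleGraph V) : Prop :=
  ∀ a b c d, G.Adj a b → G.Adj a c → G.Adj a d → b ≠ c → b ≠ d → c ≠ d →
    G.Adj b c ∨ G.Adj b d ∨ G.Adj c d

lemma isClawFree_of_not_isIndContained (h : ¬ (subdividedClaw 1).IsIndContained G) :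
    G.IsClawFree := by
  intro a b c d hab hac had hbc hbd hcd
  by_contra! hcon
  obtain ⟨n1, n2, n3⟩ := hcon
  apply h
  have key : ∀ i j, G.Adj (![b, c, d] i) (![b, c, d] j) ↔ False := by
    intro i j
    fin_cases i <;> fin_cases j <;>
      simp [n1, n2, n3, G.adj_comm c b, G.adj_comm d b, G.adj_comm d c]
  have hadj : ∀ i, G.Adj a (![b, c, d] i) := by
    intro i
    fin_cases i
    exacts [hab, hac, had]
  have hinj : ∀ i j, ![b, c, d] i = ![b, c, d] j → i = j := by
    intro i j
    fin_cases i <;> fin_cases j <;> simp [hbc, hbd, hcd, hbc.symm, hbd.symm, hcd.symm]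
  refine ⟨⟨⟨fun x => x.elim a fun y => ![b, c, d] y.1, ?_⟩, ?_⟩⟩
  · rintro (_ | ⟨i, x⟩) (_ | ⟨j, y⟩) h
    · rfl
    · exact absurd h (hadj j).ne
    · exact absurd h (hadj i).ne'
    · rw [hinj i j h, Subsingleton.elim x y]
  · rintro (_ | ⟨i, x⟩) (_ | ⟨j, y⟩)
    · simp
    · exact iff_of_true (hadj j) (by show y.val = 0; omega)
    · exact iff_of_true (hadj i).symm (by show x.val = 0; omega)
    · show G.Adj (![b, c, d] i) (![b, c, d] j) ↔ i = j ∧ (x.val + 1 = y.val ∨ y.val + 1 = x.val)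
      rw [key, false_iff]
      omega

lemma exists_embedding_subdividedNet_zero {a b c : V} (hab : G.Adj a b) (hac : G.Adj a c)
    (hbc : G.Adj b c) : ∃ f : subdividedNet 0 ↪g G, ∀ x, f x = a ∨ f x = b ∨ f x = c := by
  have hadj : ∀ i j, G.Adj (![a, b, c] i) (![a, b, c] j) ↔ i ≠ j := by
    intro i j
    fin_cases i <;> fin_cases j <;> simp [hab, hac, hbc, hab.symm, hac.symm, hbc.symm]
  refine ⟨⟨⟨fun x => ![a, b, c] x.1, ?_⟩, ?_⟩, ?_⟩
  · rintro ⟨i, x⟩ ⟨j, y⟩ h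
    have hij : i = j := by
      by_contra hne
      exact ((hadj i j).2 hne).ne h
    have hxy : x = y := by
      ext
      omega
    rw [hij, hxy]
  · rintro ⟨i, x⟩ ⟨j, y⟩
    show G.Adj (![a, b, c] i) (![a, b, c] j) ↔ (i = j ∧ (x.val + 1 = y.val ∨ y.val + 1 = x.val)) ∨
      (i ≠ j ∧ x.val = 0 ∧ y.val = 0)
    rw [hadj]
    omega
  · rintro ⟨i, x⟩
    show ![a, b, c] i = a ∨ ![a, b, c] i = b ∨ ![a, b, c] i = c
    fin_cases i <;> simp

/-- A connected set without triangles in a claw-free graph is traced by a path. -/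
lemma IsConnOn.exists_isChain {S : Finset V} (hS : G.IsConnOn S) (hclaw : G.IsClawFree)
    (htri : ∀ a ∈ S, ∀ b ∈ S, ∀ c ∈ S, G.Adj a b → G.Adj a c → ¬ G.Adj b c) :
    ∃ l : List V, l.IsChain G.Adj ∧ l.Nodup ∧ ∀ v, v ∈ l ↔ v ∈ S := by
  let Q : ℕ → Prop := fun n => ∃ l : List V, l.IsChain G.Adj ∧ l.Nodup ∧ (∀ v ∈ l, v ∈ S) ∧
    l ≠ [] ∧ l.length = n
  have hQb : ∀ n, Q n → n ≤ #S := by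
    rintro n ⟨l, -, hl, hlS, -, rfl⟩
    rw [← List.toFinset_card_of_nodup hl]
    exact card_le_card fun v hv => hlS v (List.mem_toFinset.1 hv)
  obtain ⟨s, hs⟩ := hS.1
  have hQ1 : Q 1 := ⟨[s], by simp, by simp, by simpa using hs, by simp, rfl⟩
  obtain ⟨l, hlc, hln, hlS, hl0, hlen⟩ := Nat.findGreatest_spec (hQb 1 hQ1) hQ1
  have hmax : ∀ l' : List V, l'.IsChain G.Adj → l'.Nodup → (∀ v ∈ l', v ∈ S) → l' ≠ [] →
      l'.length ≤ l.length := by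
    intro l' h1 h2 h3 h4
    rw [hlen]
    have : Q l'.length := ⟨l', h1, h2, h3, h4, rfl⟩
    exact Nat.le_findGreatest (hQb _ this) this
  refine ⟨l, hlc, hln, fun v => ⟨hlS v, fun hv => ?_⟩⟩
  by_contra hvl
  -- A longest path of `S` misses nothing: a missed `b` adjacent to an end would extend it, and one
  -- adjacent to an inner vertex would create a claw or a triangle there.
  obtain ⟨a, ha, b, hb, hbl, hab⟩ := hS.exists_adj_of_ne (T := l.toFinset)
    (by obtain ⟨x, hx⟩ := List.exists_mem_of_ne_nil l hl0; exact ⟨x, by simpa using hx⟩)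
    (fun v hv => hlS v (List.mem_toFinset.1 hv)) (fun e => hvl (List.mem_toFinset.1 (e ▸ hv)))
  rw [List.mem_toFinset] at ha hbl
  obtain ⟨s, t, rfl⟩ := List.append_of_mem ha
  rcases List.eq_nil_or_concat s with rfl | ⟨s, c, rfl⟩
  · have := hmax (b :: a :: t) (List.isChain_cons_cons.2 ⟨hab.symm, hlc⟩)
      (List.nodup_cons.2 ⟨hbl, hln⟩) (by
        intro v hv
        rcases List.mem_cons.1 hv with rfl | hv
        · exact hb
        · exact hlS v hv) (by simp)
    simp at this
  rcases t with _ | ⟨d, t⟩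
  · have := hmax (((s ++ [c]) ++ [a]) ++ [b]) (List.isChain_append.2 ⟨by simpa using hlc, by simp,
        by simpa using hab⟩)
      (List.nodup_append.2 ⟨by simpa using hln, by simp, by
        intro x hx y hy e
        rw [List.mem_singleton] at hy
        exact hbl (by rw [← hy, ← e]; simpa using hx)⟩) (by
        intro v hv
        rcases List.mem_append.1 hv with hv | hv
        · exact hlS v (by simpa using hv)
        · rw [List.mem_singleton.1 hv]
          exact hb) (by simp)
    simp at this
  · have hca : G.Adj c a := by
      have := hlc
      simp only [List.concat_eq_append, List.append_assoc, List.singleton_append] at this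
      exact (List.isChain_append_cons_cons.1 this).2.1
    have had : G.Adj a d := (List.isChain_append_cons_cons.1 hlc).2.1
    have hcd : c ≠ d := by
      rintro rfl
      simp [List.nodup_append] at hln
    have hcb : c ≠ b := by
      rintro rfl
      exact hbl (by simp)
    have hdb : d ≠ b := by
      rintro rfl
      exact hbl (by simp)
    have haS := hlS a (by simp)
    have hcS := hlS c (by simp)
    have hdS := hlS d (by simp)
    rcases hclaw a c d b hca.symm had hab hcd hcb hdb with h | h | h
    · exact htri a haS c hcS d hdS hca.symm had h
    · exact htri a haS c hcS b hb hca.symm hab h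
    · exact htri a haS d hdS b hb had hab h

/-- A finite set in which among any three vertices two are adjacent is covered by two paths. -/
lemma exists_two_isChain (X : Finset V)
    (hX : ∀ a ∈ X, ∀ b ∈ X, ∀ c ∈ X, a ≠ b → a ≠ c → b ≠ c →
      G.Adj a b ∨ G.Adj a c ∨ G.Adj b c) :
    ∃ l₁ l₂ : List V, l₁.IsChain G.Adj ∧ l₂.IsChain G.Adj ∧ (l₁ ++ l₂).Nodup ∧
      ∀ v, v ∈ l₁ ++ l₂ ↔ v ∈ X := by
  induction X using Finset.induction_on with
  | empty => exact ⟨[], [], by simp⟩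
  | insert x X hx ih =>
    obtain ⟨l₁, l₂, h1, h2, h3, h4⟩ := ih fun a ha b hb c hc =>
      hX a (mem_insert_of_mem ha) b (mem_insert_of_mem hb) c (mem_insert_of_mem hc)
    have hxl : x ∉ l₁ ++ l₂ := fun h => hx ((h4 x).1 h)
    rcases l₁ with _ | ⟨a, l₁⟩
    · refine ⟨[x], l₂, by simp, h2, List.nodup_cons.2 ⟨hxl, h3⟩, fun v => ?_⟩
      rw [mem_insert, ← h4]
      simp
    rcases l₂ with _ | ⟨b, l₂⟩
    · refine ⟨[x], a :: l₁, by simp, h1, List.nodup_cons.2 ⟨by simpa using hxl, by simpa using h3⟩,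
        fun v => ?_⟩
      rw [mem_insert, ← h4]
      simp
    have haX : a ∈ X := (h4 a).1 (by simp)
    have hbX : b ∈ X := (h4 b).1 (by simp)
    have hab : a ≠ b := by
      rintro rfl
      simp [List.nodup_append] at h3
    -- Among `x` and the two heads, some pair is adjacent: either `x` extends a path, or the two
    -- paths merge at their heads and `x` starts a new one.
    rcases hX x (mem_insert_self _ _) a (mem_insert_of_mem haX) b (mem_insert_of_mem hbX)
      (fun e => hx (e ▸ haX)) (fun e => hx (e ▸ hbX)) hab with h | h | h
    · refine ⟨x :: a :: l₁, b :: l₂, List.isChain_cons_cons.2 ⟨h, h1⟩, h2,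
        List.nodup_cons.2 ⟨hxl, h3⟩, fun v => ?_⟩
      rw [mem_insert, ← h4]
      simp
    · refine ⟨x :: b :: l₂, a :: l₁, List.isChain_cons_cons.2 ⟨h, h2⟩, h1,
        List.nodup_cons.2 ⟨?_, List.nodup_append_comm.1 h3⟩, fun v => ?_⟩
      · change x ∉ (b :: l₂) ++ (a :: l₁)
        simp only [List.cons_append, List.mem_cons, List.mem_append] at hxl ⊢
        tauto
      · rw [mem_insert, ← h4]
        simp only [List.cons_append, List.mem_cons, List.mem_append]
        tauto
    · refine ⟨[x], (a :: l₁).reverse ++ b :: l₂, by simp, List.isChain_append.2 ⟨?_, h2, ?_⟩,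
        List.nodup_cons.2 ⟨?_, ?_⟩, fun v => ?_⟩
      · rw [List.isChain_reverse]
        exact h1.imp fun _ _ => Adj.symm
      · simpa using h
      · simpa [or_comm, or_assoc, or_left_comm] using hxl
      · exact ((List.reverse_perm (a :: l₁)).append_right (b :: l₂)).nodup_iff.2 h3
      · rw [mem_insert, ← h4]
        simp [or_left_comm]

lemma isChain_toList_of_isClique {X : Finset V} (hX : ∀ a ∈ X, ∀ b ∈ X, a ≠ b → G.Adj a b) :
    X.toList.IsChain G.Adj := by
  have h : X.toList.Pairwise (· ≠ ·) := X.nodup_toList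
  refine List.Pairwise.isChain (h.imp_of_mem ?_)
  intro a b ha hb hab
  exact hX a (mem_toList.1 ha) b (mem_toList.1 hb) hab

/-- Insertion of the vertices that a path dominates, except those adjacent to the predecessor `c`
of its first vertex. -/
lemma exists_isChain_insert_tail (hclaw : G.IsClawFree) : ∀ (l : List V) (c y : V) (U : Finset V),
    (c :: y :: l).IsChain G.Adj → (c :: y :: l).Nodup →
    (∀ a ∈ c :: y :: l, ∀ b ∈ c :: y :: l, ∀ d ∈ c :: y :: l,
      G.Adj a b → G.Adj a d → ¬ G.Adj b d) →
    (∀ x ∈ U, x ∉ c :: y :: l ∧ ¬ G.Adj x c ∧ ∃ z ∈ y :: l, G.Adj x z) →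
    ∃ l' : List V, (y :: l').IsChain G.Adj ∧ (y :: l').Nodup ∧
      ∀ v, v ∈ y :: l' ↔ v ∈ y :: l ∨ v ∈ U := by
  intro l
  induction l with
  | nil =>
    intro c y U hch hnd htri hU
    have hcy : G.Adj c y := (List.isChain_cons_cons.1 hch).1
    have hUy : ∀ x ∈ U, G.Adj x y := fun x hx => by simpa using (hU x hx).2.2
    have hcl : ∀ a ∈ U, ∀ b ∈ U, a ≠ b → G.Adj a b := by
      intro a ha b hb hab
      have h1 := hU a ha
      have h2 := hU b hb
      rcases hclaw y c a b hcy.symm (hUy a ha).symm (hUy b hb).symm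
        (by rintro rfl; simp at h1) (by rintro rfl; simp at h2) hab with h | h | h
      · exact absurd h.symm h1.2.1
      · exact absurd h.symm h2.2.1
      · exact h
    refine ⟨U.toList, List.isChain_cons.2 ⟨fun x hx => ?_, isChain_toList_of_isClique hcl⟩,
      List.nodup_cons.2 ⟨fun h => ?_, U.nodup_toList⟩, fun v => by simp⟩
    · exact (hUy x (mem_toList.1 (List.mem_of_mem_head? hx))).symm
    · exact (hU y (mem_toList.1 h)).1 (by simp)
  | cons z l ih =>
    intro c y U hch hnd htri hU
    have hcy : G.Adj c y := (List.isChain_cons_cons.1 hch).1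
    have hyz : G.Adj y z := (List.isChain_cons_cons.1 (List.isChain_cons_cons.1 hch).2).1
    have hcz : c ≠ z := by
      rintro rfl
      simp at hnd
    have hcz' : ¬ G.Adj c z := htri y (by simp) c (by simp) z (by simp) hcy.symm hyz
    -- Claws at `y` containing the predecessor `c` show that `X` is a clique adjacent to `z`, so it
    -- fits between `y` and `z`. The rest of `U` is not adjacent to `y`, which then serves as the
    -- predecessor.
    set X := U.filter (G.Adj y) with hXdef
    have hXU : ∀ x ∈ X, x ∈ U ∧ G.Adj y x := fun x hx => mem_filter.1 hx
    have hXz : ∀ x ∈ X, G.Adj x z := by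
      intro x hx
      obtain ⟨hxU, hyx⟩ := hXU x hx
      have h1 := hU x hxU
      rcases hclaw y c z x hcy.symm hyz hyx hcz (by rintro rfl; simp at h1)
        (by rintro rfl; simp at h1) with h | h | h
      · exact absurd h hcz'
      · exact absurd h.symm h1.2.1
      · exact h.symm
    have hcl : ∀ a ∈ X, ∀ b ∈ X, a ≠ b → G.Adj a b := by
      intro a ha b hb hab
      obtain ⟨haU, hya⟩ := hXU a ha
      obtain ⟨hbU, hyb⟩ := hXU b hb
      have h1 := hU a haU
      have h2 := hU b hbU
      rcases hclaw y c a b hcy.symm hya hyb (by rintro rfl; simp at h1)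
        (by rintro rfl; simp at h2) hab with h | h | h
      · exact absurd h.symm h1.2.1
      · exact absurd h.symm h2.2.1
      · exact h
    obtain ⟨l', hl'c, hl'n, hl'm⟩ := ih y z (U \ X) (List.isChain_cons_cons.1 hch).2
      (List.nodup_cons.1 hnd).2 (fun a ha b hb d hd =>
        htri a (List.mem_cons_of_mem _ ha) b (List.mem_cons_of_mem _ hb) d
          (List.mem_cons_of_mem _ hd)) (by
        intro x hx
        obtain ⟨hxU, hxX⟩ := mem_sdiff.1 hx
        have hyx : ¬ G.Adj y x := fun h => hxX (mem_filter.2 ⟨hxU, h⟩)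
        obtain ⟨h1, h2, w, hw, hxw⟩ := hU x hxU
        refine ⟨fun h => h1 (List.mem_cons_of_mem _ h), fun h => hyx h.symm, w, ?_, hxw⟩
        rcases List.mem_cons.1 hw with rfl | hw
        · exact absurd hxw.symm hyx
        · exact hw)
    refine ⟨X.toList ++ z :: l', ?_, ?_, fun v => ?_⟩
    · rw [List.isChain_cons]
      refine ⟨fun x hx => ?_, List.isChain_append.2
        ⟨isChain_toList_of_isClique hcl, hl'c, fun x hx w hw => ?_⟩⟩
      · rcases hX : X.toList with _ | ⟨x', t⟩
        · rw [hX] at hx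
          simp at hx
          exact hx ▸ hyz
        · have : x' ∈ X := mem_toList.1 (by rw [hX]; simp)
          rw [hX] at hx
          simp at hx
          exact hx ▸ (hXU x' this).2
      · simp only [List.head?_cons, Option.mem_def, Option.some.injEq] at hw
        exact hw ▸ hXz x (mem_toList.1 (List.mem_of_mem_getLast? hx))
    · rw [List.nodup_cons, List.nodup_append]
      refine ⟨fun h => ?_, X.nodup_toList, hl'n, fun a ha b hb e => ?_⟩
      · rcases List.mem_append.1 h with h | h
        · exact (hU y (hXU y (mem_toList.1 h)).1).1 (by simp)
        · rcases (hl'm y).1 h with h | h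
          · exact (List.nodup_cons.1 (List.nodup_cons.1 hnd).2).1 h
          · exact (hU y (mem_sdiff.1 h).1).1 (by simp)
      · subst e
        rw [mem_toList] at ha
        rcases (hl'm a).1 hb with h | h
        · exact (hU a (hXU a ha).1).1 (by simp at h ⊢; tauto)
        · exact (mem_sdiff.1 h).2 ha
    · rw [List.mem_cons, List.mem_append, hl'm, mem_toList, mem_sdiff,
        List.mem_cons (a := v) (b := y)]
      have := hXU v
      tauto

/-- In a claw-free graph, a dominating path without triangles extends to a Hamiltonian path. -/
lemma exists_isChain_hamiltonian [Fintype V] (hclaw : G.IsClawFree) {l : List V}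
    (hl0 : l ≠ []) (hch : l.IsChain G.Adj) (hnd : l.Nodup)
    (htri : ∀ a ∈ l, ∀ b ∈ l, ∀ d ∈ l, G.Adj a b → G.Adj a d → ¬ G.Adj b d)
    (hdom : ∀ v, v ∈ l ∨ ∃ y ∈ l, G.Adj v y) :
    ∃ l' : List V, l'.IsChain G.Adj ∧ l'.Nodup ∧ ∀ v, v ∈ l' := by
  obtain ⟨y, l, rfl⟩ := List.exists_cons_of_ne_nil hl0
  set X : Finset V := univ.filter fun x => x ∉ y :: l ∧ G.Adj y x with hX
  have hXm : ∀ x, x ∈ X ↔ x ∉ y :: l ∧ G.Adj y x := fun x => by rw [hX, mem_filter]; simp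
  -- The first vertex `y` has no predecessor, so its outside neighbours need not form a clique; they
  -- are split into one path before `y` and one after it.
  obtain ⟨l₁, l₂, h1, h2, h3, h4⟩ := exists_two_isChain (G := G) X fun a ha b hb c hc =>
    hclaw y a b c ((hXm a).1 ha).2 ((hXm b).1 hb).2 ((hXm c).1 hc).2
  have hyX : y ∉ X := fun h => by simpa using ((hXm y).1 h)
  have hadj1 : ∀ {l₁ l₂ : List V}, (∀ v, v ∈ l₁ ++ l₂ ↔ v ∈ X) → ∀ x ∈ l₁, G.Adj x y :=
    fun h x hx => ((hXm x).1 ((h x).1 (List.mem_append_left _ hx))).2.symm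
  have hadj2 : ∀ {l₁ l₂ : List V}, (∀ v, v ∈ l₁ ++ l₂ ↔ v ∈ X) → ∀ x ∈ l₂, G.Adj y x :=
    fun h x hx => ((hXm x).1 ((h x).1 (List.mem_append_right _ hx))).2
  have hchain : ∀ {l₁ l₂ : List V}, l₁.IsChain G.Adj → l₂.IsChain G.Adj →
      (∀ v, v ∈ l₁ ++ l₂ ↔ v ∈ X) → (l₁ ++ y :: l₂).IsChain G.Adj := by
    intro l₁ l₂ h1 h2 h4
    refine List.isChain_append.2 ⟨h1, List.isChain_cons.2 ⟨fun x hx => ?_, h2⟩, fun x hx w hw => ?_⟩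
    · exact hadj2 h4 x (List.mem_of_mem_head? hx)
    · simp only [List.head?_cons, Option.mem_def, Option.some.injEq] at hw
      exact hw ▸ hadj1 h4 x (List.mem_of_mem_getLast? hx)
  have hnodup : ∀ {l₁ l₂ : List V}, (l₁ ++ l₂).Nodup → (∀ v, v ∈ l₁ ++ l₂ ↔ v ∈ X) →
      (l₁ ++ y :: l₂).Nodup := by
    intro l₁ l₂ h3 h4
    rw [List.perm_middle.nodup_iff, List.nodup_cons]
    exact ⟨fun h => hyX ((h4 y).1 h), h3⟩
  rcases l with _ | ⟨z, l⟩
  · refine ⟨l₁ ++ y :: l₂, hchain h1 h2 h4, hnodup h3 h4, fun v => ?_⟩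
    rw [List.perm_middle.mem_iff, List.mem_cons, h4, hXm]
    rcases hdom v with h | ⟨w, hw, hvw⟩
    · exact Or.inl (by simpa using h)
    · rw [List.mem_singleton] at hw
      subst hw
      exact Or.inr ⟨by simpa using hvw.ne, hvw.symm⟩
  have hyz : G.Adj y z := (List.isChain_cons_cons.1 hch).1
  have hzX : z ∉ X := fun h => by simpa using ((hXm z).1 h).1
  have hclq : ∀ a ∈ X, ∀ b ∈ X, a ≠ b → ¬ G.Adj a z → ¬ G.Adj b z → G.Adj a b := by
    intro a ha b hb hab haz hbz
    rcases hclaw y a b z ((hXm a).1 ha).2 ((hXm b).1 hb).2 hyz hab (fun e => hzX (e ▸ ha))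
      (fun e => hzX (e ▸ hb)) with h | h | h
    · exact h
    · exact absurd h haz
    · exact absurd h hbz
  -- The path after `y` must end next to `z`. If neither path does, their last vertices are adjacent
  -- by claw-freeness at `y`, so they merge into one path before `y`, and `y` is followed by `z`
  -- directly.
  obtain ⟨m₁, m₂, g1, g2, g3, g4, g5⟩ : ∃ l₁ l₂ : List V, l₁.IsChain G.Adj ∧ l₂.IsChain G.Adj ∧
      (l₁ ++ l₂).Nodup ∧ (∀ v, v ∈ l₁ ++ l₂ ↔ v ∈ X) ∧ ∀ x ∈ l₂.getLast?, G.Adj x z := by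
    by_cases e2 : ∀ x ∈ l₂.getLast?, G.Adj x z
    · exact ⟨l₁, l₂, h1, h2, h3, h4, e2⟩
    by_cases e1 : ∀ x ∈ l₁.getLast?, G.Adj x z
    · exact ⟨l₂, l₁, h2, h1, List.nodup_append_comm.1 h3, fun v => by
        rw [← h4, List.mem_append, List.mem_append, or_comm], e1⟩
    · push Not at e1 e2
      obtain ⟨x₁, hx₁, e1⟩ := e1
      obtain ⟨x₂, hx₂, e2⟩ := e2
      have m1 := List.mem_of_mem_getLast? hx₁
      have m2 := List.mem_of_mem_getLast? hx₂
      refine ⟨l₁ ++ l₂.reverse, [], List.isChain_append.2 ⟨h1, ?_, fun a ha b hb => ?_⟩, by simp,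
        ?_, fun v => ?_, by simp⟩
      · rw [List.isChain_reverse]
        exact h2.imp fun _ _ => Adj.symm
      · rw [List.head?_reverse] at hb
        rw [Option.mem_unique ha hx₁, Option.mem_unique hb hx₂]
        exact hclq x₁ ((h4 x₁).1 (List.mem_append_left _ m1)) x₂
          ((h4 x₂).1 (List.mem_append_right _ m2))
          (List.nodup_append.1 h3 |>.2.2 x₁ m1 x₂ m2) e1 e2
      · rw [List.append_nil]
        exact ((List.reverse_perm l₂).append_left l₁).nodup_iff.2 h3
      · rw [← h4]
        simp
  set U : Finset V := univ.filter fun x => x ∉ y :: z :: l ∧ ¬ G.Adj y x with hU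
  have hUm : ∀ x, x ∈ U ↔ x ∉ y :: z :: l ∧ ¬ G.Adj y x := fun x => by rw [hU, mem_filter]; simp
  obtain ⟨l', hl'c, hl'n, hl'm⟩ := exists_isChain_insert_tail hclaw l y z U hch hnd htri (by
    intro x hx
    obtain ⟨hx1, hx2⟩ := (hUm x).1 hx
    refine ⟨hx1, fun h => hx2 h.symm, ?_⟩
    obtain ⟨w, hw, hxw⟩ := (hdom x).resolve_left hx1
    rcases List.mem_cons.1 hw with rfl | hw
    · exact absurd hxw.symm hx2
    · exact ⟨w, hw, hxw⟩)
  refine ⟨(m₁ ++ y :: m₂) ++ z :: l', List.isChain_append.2 ⟨hchain g1 g2 g4, hl'c, ?_⟩,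
    List.nodup_append.2 ⟨hnodup g3 g4, hl'n, ?_⟩, fun v => ?_⟩
  · intro x hx w hw
    simp only [List.head?_cons, Option.mem_def, Option.some.injEq] at hw
    subst hw
    rcases m₂ with _ | ⟨b, m₂⟩
    · simp at hx
      exact hx ▸ hyz
    · refine g5 x ?_
      simpa [List.getLast?_append, List.getLast?_cons_cons] using hx
  · rintro a ha b hb rfl
    rw [List.perm_middle.mem_iff, List.mem_cons, g4, hXm] at ha
    rcases (hl'm a).1 hb with h | h
    · rcases ha with rfl | ha
      · exact (List.nodup_cons.1 hnd).1 h
      · exact ha.1 (List.mem_cons_of_mem _ h)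
    · have := (hUm a).1 h
      rcases ha with rfl | ha
      · simp at this
      · exact this.2 ha.2
  · rw [List.mem_append, List.perm_middle.mem_iff, List.mem_cons, g4, hXm, hl'm, hUm]
    have := List.mem_cons (a := v) (b := y) (l := z :: l)
    tauto

/-- A connected graph without induced claws and nets has a Hamiltonian path. -/
lemma exists_isChain_hamiltonian_of_isConnOn [Fintype V] (hG : G.IsConnOn univ)
    (hclaw : ¬ (subdividedClaw 1).IsIndContained G)
    (hnet : ¬ (subdividedNet 1).IsIndContained G) :
    ∃ l : List V, l.IsChain G.Adj ∧ l.Nodup ∧ ∀ v, v ∈ l := by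
  obtain ⟨S, hS, hdom, hpriv⟩ := exists_hasPrivateTriples hG
  have hcf := isClawFree_of_not_isIndContained hclaw
  have htri : ∀ a ∈ S, ∀ b ∈ S, ∀ c ∈ S, G.Adj a b → G.Adj a c → ¬ G.Adj b c := by
    intro a ha b hb c hc hab hac hbc
    obtain ⟨f, hf⟩ := exists_embedding_subdividedNet_zero hab hac hbc
    refine hnet (hS.subdividedNet_succ hpriv f fun x => ?_)
    rcases hf x with h | h | h <;> rw [h] <;> assumption
  obtain ⟨l, h1, h2, h3⟩ := hS.exists_isChain hcf htri
  refine exists_isChain_hamiltonian hcf (l := l) ?_ h1 h2 (fun a ha b hb d hd =>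
    htri a ((h3 a).1 ha) b ((h3 b).1 hb) d ((h3 d).1 hd)) fun v => ?_
  · rintro rfl
    obtain ⟨s, hs⟩ := hS.1
    simpa using (h3 s).2 hs
  · simpa only [h3] using hdom v

/-! ### Central paths and the induction on `k` -/

/-- Some path of `G` is at distance at most `m` from every vertex. -/
def HasCentralPath (G : SimpleGraph V) (m : ℕ) : Prop :=
  ∃ (u v : V) (p : G.Walk u v), p.IsPath ∧ ∀ x, ∃ y ∈ p.support, G.edist x y ≤ m

lemma pathEccentricity_le_iff {m : ℕ} : G.pathEccentricity ≤ m ↔ G.HasCentralPath m := by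
  constructor
  · intro h
    -- A strict bound by `m + 1` produces witnesses for the infima, which `≤ m` does not do
    -- directly.
    have h1 : G.pathEccentricity < ((m + 1 : ℕ) : ℕ∞) :=
      h.trans_lt (by exact_mod_cast Nat.lt_succ_self m)
    simp only [pathEccentricity, iInf_lt_iff] at h1
    obtain ⟨u, v, p, hp, h2⟩ := h1
    refine ⟨u, v, p, hp, fun x => ?_⟩
    have h3 : ⨅ y ∈ p.support, G.edist x y < ((m + 1 : ℕ) : ℕ∞) :=
      (le_iSup (fun x => ⨅ y ∈ p.support, G.edist x y) x).trans_lt h2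
    simp only [iInf_lt_iff] at h3
    obtain ⟨y, hy, h4⟩ := h3
    refine ⟨y, hy, ?_⟩
    push_cast at h4
    exact Order.le_of_lt_add_one h4
  · rintro ⟨u, v, p, hp, h⟩
    refine (iInf₂_le u v).trans ((iInf₂_le p hp).trans (iSup_le fun x => ?_))
    obtain ⟨y, hy, h1⟩ := h x
    exact (iInf₂_le y hy).trans h1

lemma edist_map_le {W : Type*} {H : SimpleGraph W} (f : G →g H) (x y : V) :
    H.edist (f x) (f y) ≤ G.edist x y := by
  by_cases h : G.edist x y = ⊤
  · simp [h]
  · obtain ⟨p, hp⟩ := exists_walk_of_edist_ne_top h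
    rw [← hp, ← Walk.length_map f p]
    exact edist_le _

lemma HasCentralPath.of_iso {W : Type*} {H : SimpleGraph W} {m : ℕ} (h : G.HasCentralPath m)
    (e : G ≃g H) : H.HasCentralPath m := by
  obtain ⟨u, v, p, hp, h⟩ := h
  refine ⟨_, _, p.map e.toHom, hp.map e.injective, fun x => ?_⟩
  obtain ⟨y, hy, hxy⟩ := h (e.symm x)
  refine ⟨e y, ?_, ?_⟩
  · rw [Walk.support_map]
    exact List.mem_map_of_mem hy
  · have := (edist_map_le e.toHom (e.symm x) y).trans hxy
    simpa using this

lemma Connected.isConnOn_univ [Fintype V] (hG : G.Connected) : G.IsConnOn univ := by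
  obtain ⟨v⟩ := hG.nonempty
  refine ⟨⟨v, mem_univ v⟩, ?_⟩
  rintro A ⟨a, ha, -⟩ hcl b -
  obtain ⟨p⟩ := hG.preconnected a b
  induction p with
  | nil => exact ha
  | cons hadj _ ih => exact ih (hcl _ ha (mem_univ _) _ (mem_univ _) hadj)

lemma IsConnOn.connected [Fintype V] (hG : G.IsConnOn univ) : G.Connected := by
  obtain ⟨r, -⟩ := hG.1
  rw [connected_iff_exists_forall_reachable]
  exact ⟨r, fun b => hG.2 {x | G.Reachable r x} ⟨r, Reachable.refl r, mem_univ r⟩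
    (fun x hx _ y _ hxy => hx.trans hxy.reachable) b (mem_univ b)⟩

lemma IsConnOn.induce {S : Finset V} [Fintype (S : Set V)] (hS : G.IsConnOn S) :
    (G.induce (S : Set V)).IsConnOn univ := by
  obtain ⟨s, hs⟩ := hS.1
  refine ⟨⟨⟨s, hs⟩, mem_univ _⟩, ?_⟩
  rintro A ⟨a, ha, -⟩ hcl ⟨b, hb⟩ -
  have := hS.2 (Subtype.val '' A) ⟨a, ⟨a, ha, rfl⟩, a.2⟩ (by
    rintro _ ⟨x, hx, rfl⟩ _ y hy hxy
    exact ⟨⟨y, hy⟩, hcl x hx (mem_univ _) ⟨y, hy⟩ (mem_univ _) hxy, rfl⟩) b hb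
  obtain ⟨y, hy, rfl⟩ := this
  exact hy

/-- A central path of a dominating induced subgraph is a central path of the graph, with
eccentricity larger by at most one. -/
lemma IsDominatingSet.hasCentralPath {S : Finset V} (hS : G.IsDominatingSet S) {m : ℕ}
    (h : (G.induce (S : Set V)).HasCentralPath m) : G.HasCentralPath (m + 1) := by
  obtain ⟨u, v, p, hp, h⟩ := h
  let f := Embedding.induce (G := G) (S : Set V)
  refine ⟨_, _, p.map f.toHom, hp.map f.injective, fun x => ?_⟩
  obtain ⟨s, hs, hxs⟩ : ∃ s ∈ S, G.edist x s ≤ 1 := by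
    rcases hS x with hx | ⟨s, hs, hxs⟩
    · exact ⟨x, hx, by simp⟩
    · exact ⟨s, hs, (edist_eq_one_iff_adj.2 hxs).le⟩
  obtain ⟨y, hy, hsy⟩ := h ⟨s, hs⟩
  refine ⟨f y, ?_, ?_⟩
  · rw [Walk.support_map]
    exact List.mem_map_of_mem hy
  · calc G.edist x (f y) ≤ G.edist x s + G.edist s (f y) := G.edist_triangle
      _ ≤ 1 + m := add_le_add hxs ((edist_map_le f.toHom ⟨s, hs⟩ y).trans hsy)
      _ = ((m + 1 : ℕ) : ℕ∞) := by push_cast; rw [add_comm]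

/-- Here `k = m + 1`. The graph varies in the induction because the step passes to the subgraph
induced on `S`. -/
theorem hasCentralPath_of_not_isIndContained (m : ℕ) : ∀ {V : Type*} [Fintype V]
    {G : SimpleGraph V}, G.IsConnOn univ → ¬ (subdividedClaw (m + 1)).IsIndContained G →
    ¬ (subdividedNet (m + 1)).IsIndContained G → G.HasCentralPath m := by
  induction m with
  | zero =>
    intro V _ G hG hclaw hnet
    obtain ⟨l, h1, h2, h3⟩ := exists_isChain_hamiltonian_of_isConnOn hG hclaw hnet
    obtain ⟨r, -⟩ := hG.1
    have hl : l ≠ [] := List.ne_nil_of_mem (h3 r)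
    refine ⟨_, _, Walk.ofSupport l hl h1, ?_, fun x => ⟨x, ?_, by simp⟩⟩
    · rwa [Walk.isPath_def, Walk.support_ofSupport]
    · rw [Walk.support_ofSupport]
      exact h3 x
  | succ m ih =>
    intro V _ G hG hclaw hnet
    obtain ⟨S, hS, hdom, hpriv⟩ := exists_hasPrivateTriples hG
    refine hdom.hasCentralPath (ih hS.induce ?_ ?_)
    · rintro ⟨f⟩
      exact hclaw (hS.subdividedClaw_succ hpriv ((Embedding.induce _).comp f) fun x => (f x).2)
    · rintro ⟨f⟩
      exact hnet (hS.subdividedNet_succ hpriv ((Embedding.induce _).comp f) fun x => (f x).2)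

/-! ### Lower bounds for the subdivided claw and net -/

/-- A walk that leaves a set `B` with a single exit `c` visits `c`. -/
lemma Walk.mem_support_of_exit {B : Set V} {c : V}
    (hB : ∀ a ∈ B, ∀ b, b ∉ B → G.Adj a b → b = c) {z w : V} (p : G.Walk z w) (hz : z ∈ B)
    (hw : w ∉ B) : c ∈ p.support := by
  induction p with
  | nil => exact absurd hz hw
  | @cons a b _ hadj q ih =>
    rw [Walk.support_cons]
    by_cases hb : b ∈ B
    · exact List.mem_cons_of_mem _ (ih hb hw)
    · rw [← hB a hz b hb hadj]
      exact List.mem_cons_of_mem _ q.start_mem_support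

/-- A path that visits a set `B` with a single exit has an end in `B`. -/
lemma Walk.IsPath.mem_or_mem_of_exit {B : Set V} {c : V} (hcB : c ∉ B)
    (hB : ∀ a ∈ B, ∀ b, b ∉ B → G.Adj a b → b = c) {u v z : V} {p : G.Walk u v} (hp : p.IsPath)
    (hz : z ∈ p.support) (hzB : z ∈ B) : u ∈ B ∨ v ∈ B := by
  by_contra! hcon
  -- With both ends outside `B`, the path would pass through `c` both before and after `z`.
  have h1 : c ∈ (p.takeUntil z hz).support := by
    have := (p.takeUntil z hz).reverse.mem_support_of_exit hB hzB hcon.1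
    rwa [Walk.support_reverse, List.mem_reverse] at this
  have h2 := (p.dropUntil z hz).mem_support_of_exit hB hzB hcon.2
  rw [Walk.mem_support_iff] at h2
  have h3 := h2.resolve_left fun e => hcB (e ▸ hzB)
  have h4 := hp.support_nodup
  rw [← p.take_spec hz, Walk.support_append] at h4
  exact (List.nodup_append.1 h4).2.2 c h1 c h3 rfl

lemma le_add_edist {φ : V → ℕ} (hφ : ∀ a b, G.Adj a b → φ a ≤ φ b + 1) (x y : V) :
    (φ x : ℕ∞) ≤ φ y + G.edist x y := by
  by_cases h : G.edist x y = ⊤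
  · simp [h]
  · obtain ⟨p, hp⟩ := exists_walk_of_edist_ne_top h
    rw [← hp]
    have : φ x ≤ φ y + p.length := by
      clear hp h
      induction p with
      | nil => simp
      | cons hadj q ih =>
        have := hφ _ _ hadj
        rw [Walk.length_cons]
        omega
    exact_mod_cast this

/-- A graph with three disjoint deep parts with single exits has no path near all vertices. -/
lemma not_hasCentralPath {m : ℕ} (φ : Fin 3 → V → ℕ) (c l : Fin 3 → V)
    (hdisj : ∀ i j x, i ≠ j → φ i x ≠ 0 → φ j x = 0) (hc : ∀ i, φ i (c i) = 0)
    (hl : ∀ i, m < φ i (l i)) (hφ : ∀ i a b, G.Adj a b → φ i a ≤ φ i b + 1)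
    (hexit : ∀ i a b, φ i a ≠ 0 → φ i b = 0 → G.Adj a b → b = c i) : ¬ G.HasCentralPath m := by
  rintro ⟨u, v, p, hp, h⟩
  -- `φ i` is the depth inside the `i`-th part and changes by at most one along an edge, so the deep
  -- vertex `l i` forces the path into that part and hence an end of the path too. Two ends cannot
  -- serve three disjoint parts.
  have key : ∀ i, φ i u ≠ 0 ∨ φ i v ≠ 0 := by
    intro i
    obtain ⟨y, hy, hly⟩ := h (l i)
    have hyB : φ i y ≠ 0 := by
      intro h0
      have h1 := le_add_edist (hφ i) (l i) y
      rw [h0, Nat.cast_zero, zero_add] at h1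
      have h2 : φ i (l i) ≤ m := by exact_mod_cast h1.trans hly
      have := hl i
      omega
    exact hp.mem_or_mem_of_exit (B := {x | φ i x ≠ 0}) (c := c i) (by simpa using hc i)
      (fun a ha b hb hab => hexit i a b ha (by simpa using hb) hab) hy hyB
  have h01 := fun x => hdisj 0 1 x (by decide)
  have h02 := fun x => hdisj 0 2 x (by decide)
  have h12 := fun x => hdisj 1 2 x (by decide)
  have h0 := key 0
  have h1 := key 1
  have h2 := key 2
  have := h01 u
  have := h01 v
  have := h02 u
  have := h02 v
  have := h12 u
  have := h12 v
  omega

lemma not_hasCentralPath_subdividedClaw (m : ℕ) : ¬ (subdividedClaw (m + 1)).HasCentralPath m := by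
  refine not_hasCentralPath (fun i x => x.elim 0 fun y => if y.1 = i then y.2.val + 1 else 0)
    (fun _ => none) (fun i => some (i, Fin.last m)) ?_ ?_ ?_ ?_ ?_
  · rintro i j (_ | ⟨l, a⟩) hij h
    · rfl
    · simp only [Option.elim_some] at h ⊢
      split_ifs at h ⊢ with h1 h2
      all_goals first | exact absurd (h2.symm.trans h1) hij | exact absurd rfl h | rfl
  · intro i
    rfl
  · intro i
    simp
  · rintro i (_ | ⟨j, a⟩) (_ | ⟨l, b⟩) h
    · simp
    · simp
    · have h : a.val = 0 := h
      simp only [Option.elim_some, Option.elim_none]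
      split_ifs <;> omega
    · obtain ⟨rfl, h⟩ : j = l ∧ (a.val + 1 = b.val ∨ b.val + 1 = a.val) := h
      simp only [Option.elim_some]
      split_ifs <;> omega
  · rintro i (_ | ⟨j, a⟩) (_ | ⟨l, b⟩) h1 h2 h
    · rfl
    · exact absurd rfl h1
    · rfl
    · obtain ⟨rfl, h⟩ : j = l ∧ (a.val + 1 = b.val ∨ b.val + 1 = a.val) := h
      simp only [Option.elim_some] at h1 h2
      split_ifs at h1 h2
      omega

lemma not_hasCentralPath_subdividedNet (m : ℕ) : ¬ (subdividedNet (m + 1)).HasCentralPath m := by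
  refine not_hasCentralPath (fun i x => if x.1 = i then x.2.val else 0)
    (fun i => (i, 0)) (fun i => (i, Fin.last (m + 1))) ?_ ?_ ?_ ?_ ?_
  · rintro i j ⟨l, a⟩ hij h
    simp only at h ⊢
    split_ifs at h ⊢ with h1 h2
    all_goals first | exact absurd (h2.symm.trans h1) hij | exact absurd rfl h | rfl
  · intro i
    simp
  · intro i
    simp
  · rintro i ⟨j, a⟩ ⟨l, b⟩ h
    have h : (j = l ∧ (a.val + 1 = b.val ∨ b.val + 1 = a.val)) ∨
      (j ≠ l ∧ a.val = 0 ∧ b.val = 0) := h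
    simp only
    split_ifs <;> omega
  · rintro i ⟨j, a⟩ ⟨l, b⟩ h1 h2 h
    have h : (j = l ∧ (a.val + 1 = b.val ∨ b.val + 1 = a.val)) ∨
      (j ≠ l ∧ a.val = 0 ∧ b.val = 0) := h
    simp only [Prod.mk.injEq, Fin.ext_iff, Fin.val_zero] at h1 h2 ⊢
    split_ifs at h1 h2 <;> omega

/-! ### Upper bounds for the subdivided claw and net -/

lemma exists_edist_le {h : V → ℕ} (hh : ∀ y, h y ≠ 0 → ∃ z, G.Adj y z ∧ h z + 1 = h y) (y : V) :
    ∃ r, h r = 0 ∧ G.edist y r ≤ h y := by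
  have key : ∀ n y, h y = n → ∃ r, h r = 0 ∧ G.edist y r ≤ n := by
    intro n
    induction n with
    | zero => exact fun y hy => ⟨y, hy, by simp⟩
    | succ n ih =>
      intro y hy
      obtain ⟨z, hyz, hz⟩ := hh y (by omega)
      obtain ⟨r, hr, hzr⟩ := ih z (by omega)
      refine ⟨r, hr, ?_⟩
      calc G.edist y r ≤ G.edist y z + G.edist z r := G.edist_triangle
        _ ≤ 1 + n := add_le_add (edist_eq_one_iff_adj.2 hyz).le hzr
        _ = ((n + 1 : ℕ) : ℕ∞) := by push_cast; rw [add_comm]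
  exact key _ y rfl

lemma hasCentralPath_subdividedClaw (k : ℕ) : (subdividedClaw k).HasCentralPath k := by
  refine ⟨none, none, .nil, .nil, fun x => ⟨none, by simp, ?_⟩⟩
  obtain ⟨r, hr, hxr⟩ := exists_edist_le (G := subdividedClaw k)
    (h := fun x => x.elim 0 fun y => y.2.val + 1) (by
      rintro (_ | ⟨i, a, ha⟩) h
      · exact absurd rfl h
      · rcases a with _ | a
        · exact ⟨none, rfl, rfl⟩
        · exact ⟨some (i, ⟨a, by omega⟩), ⟨rfl, Or.inr rfl⟩, rfl⟩) x
  rcases r with _ | ⟨j, b⟩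
  · refine hxr.trans (Nat.cast_le.2 ?_)
    rcases x with _ | ⟨i, a⟩
    · exact Nat.zero_le _
    · exact a.2
  · exact absurd hr (Nat.succ_ne_zero _)

lemma hasCentralPath_subdividedNet (k : ℕ) : (subdividedNet k).HasCentralPath k := by
  have hadj : ∀ i j : Fin 3, i ≠ j → (subdividedNet k).Adj (i, 0) (j, 0) :=
    fun i j hij => Or.inr ⟨hij, rfl, rfl⟩
  -- The path runs through all three triangle vertices, so every leg starts on it.
  refine ⟨(0, 0), (2, 0), .cons (hadj 0 1 (by decide)) (.cons (hadj 1 2 (by decide)) .nil), ?_,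
    fun x => ?_⟩
  · rw [Walk.isPath_def]
    simp
  obtain ⟨⟨i, b⟩, hr, hxr⟩ := exists_edist_le (G := subdividedNet k) (h := fun x => x.2.val) (by
    rintro ⟨i, a, ha⟩ h
    rcases a with _ | a
    · exact absurd rfl h
    · exact ⟨(i, ⟨a, by omega⟩), Or.inl ⟨rfl, Or.inr rfl⟩, rfl⟩) x
  refine ⟨(i, b), ?_, hxr.trans (Nat.cast_le.2 (by have := x.2.2; omega))⟩
  have hb : b = 0 := Fin.ext hr
  subst hb
  fin_cases i <;> simp

lemma pathEccentricity_eq_succ_iff {m : ℕ} :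
    G.pathEccentricity = ((m + 1 : ℕ) : ℕ∞) ↔ G.HasCentralPath (m + 1) ∧ ¬ G.HasCentralPath m := by
  rw [← pathEccentricity_le_iff, ← pathEccentricity_le_iff, le_antisymm_iff, not_le]
  refine and_congr_right fun _ => ?_
  rw [Nat.cast_succ, ENat.add_one_le_iff (ENat.natCast_ne_top m)]

lemma pathEccentricity_lt_succ_iff {m : ℕ} :
    G.pathEccentricity < ((m + 1 : ℕ) : ℕ∞) ↔ G.HasCentralPath m := by
  rw [← pathEccentricity_le_iff, Nat.cast_succ, ENat.lt_add_one_iff (ENat.natCast_ne_top m)]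

end SimpleGraph

theorem theorem3 (k : ℕ) (hk : 1 ≤ k) {V : Type*} [Finite V] (G : SimpleGraph V) :
    ((∀ s : Set V, (G.induce s).Connected → (G.induce s).pathEccentricity < (k : ℕ∞)) ↔
      (¬ (SimpleGraph.subdividedClaw k).IsIndContained G ∧
        ¬ (SimpleGraph.subdividedNet k).IsIndContained G)) ∧
    (SimpleGraph.subdividedClaw k).pathEccentricity = (k : ℕ∞) ∧
    (SimpleGraph.subdividedNet k).pathEccentricity = (k : ℕ∞) := by
  obtain ⟨m, rfl⟩ : ∃ m, k = m + 1 := ⟨k - 1, by omega⟩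
  refine ⟨⟨fun h => ⟨?_, ?_⟩, fun ⟨hclaw, hnet⟩ s hs => ?_⟩, ?_, ?_⟩
  · rintro ⟨f⟩
    have h1 := h (Set.range f) (f.isoInduceRange.connected_iff.1
      (SimpleGraph.isConnOn_subdividedClaw (m + 1)).connected)
    exact SimpleGraph.not_hasCentralPath_subdividedClaw m
      ((SimpleGraph.pathEccentricity_lt_succ_iff.1 h1).of_iso f.isoInduceRange.symm)
  · rintro ⟨f⟩
    have h1 := h (Set.range f) (f.isoInduceRange.connected_iff.1
      (SimpleGraph.isConnOn_subdividedNet (m + 1)).connected)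
    exact SimpleGraph.not_hasCentralPath_subdividedNet m
      ((SimpleGraph.pathEccentricity_lt_succ_iff.1 h1).of_iso f.isoInduceRange.symm)
  · have := Fintype.ofFinite s
    refine SimpleGraph.pathEccentricity_lt_succ_iff.2
      (SimpleGraph.hasCentralPath_of_not_isIndContained m hs.isConnOn_univ ?_ ?_)
    · exact fun h => hclaw (h.trans ⟨SimpleGraph.Embedding.induce s⟩)
    · exact fun h => hnet (h.trans ⟨SimpleGraph.Embedding.induce s⟩)
  · exact SimpleGraph.pathEccentricity_eq_succ_iff.2
      ⟨SimpleGraph.hasCentralPath_subdividedClaw _, SimpleGraph.not_hasCentralPath_subdividedClaw m⟩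
  · exact SimpleGraph.pathEccentricity_eq_succ_iff.2
      ⟨SimpleGraph.hasCentralPath_subdividedNet _, SimpleGraph.not_hasCentralPath_subdividedNet m⟩
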